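/- **Theorem (Birkhoff-type theorem for relative algebraic theories).** Let $\lambda$ be an infinite regular cardinal, $S$ a set of sorts, $\Sigma$ an $S$-sorted $\lambda$-ary signature and $\mathbb{S}$ a $\lambda$-ary partial Horn theory over $\Sigma$. Let $(\Omega,E)$ be an $\mathbb{S}$-relative $\lambda$-ary algebraic theory, with forgetful functor $U\colon \mathbf{Alg}(\Omega,E)\to\mathbf{PMod}\,\mathbb{S}$. Then, for every replete full subcategory $\mathscr{E}\subseteq\mathbf{Alg}(\Omega,E)$, the following are equivalent: 1. $\mathscr{E}$ is definable by $\mathbb{S}$-relative $\lambda$-ary judgments, i.e., there is a set $E'$ of $\mathbb{S}$-relative $\lambda$-ary judgments such that $\mathscr{E}=\mathbf{Alg}(\Omega,E\cup E')$. 2. $\mathscr{E}\subseteq\mathbf{Alg}(\Omega,E)$ is closed under (small) products, $\Sigma$-closed subobjects, $U$-retracts, and (small) $\lambda$-filtered colimits. The notions are as follows. *Syntax.* The signature $\Sigma$ consists of a set of function symbols $f\colon\sqcap_{i<\alpha}s_i\to s$ and a set of relation symbols $R\colon\sqcap_{i<\alpha}s_i$, with $\alpha<\lambda$ and $s_i,s\in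 S$. A context is a tuple $\vec x=(x_i{:}s_i)_{i<\alpha}$ of distinct sorted variables with $\alpha<\lambda$. Terms in a context are built from its variables by function symbols. Horn formulas in a context are built from $R(\tau_j)_j$, $\tau=\tau'$ (terms of the same sort) and $\top$ by conjunctions $\bigwedge_{j<\beta}\phi_j$ with $\beta<\lambda$. A Horn sequent $\phi\vdash_{\vec x}\psi$ is a pair of Horn formulas in the same context $\vec x$; a $\lambda$-ary partial Horn theory over $\Sigma$ is a set of Horn sequents over $\Sigma$. *Models.* A partial $\Sigma$-structure $M$ consists of sets $M_s$ $(s\in S)$, partial maps $[\![f]\!]_M\colon\prod_{i<\alpha}M_{s_i}\rightharpoonup M_s$ and subsets $[\![R]\!]_M\subseteq\prod_{i<\alpha}M_{s_i}$. Terms are interpreted as partial maps ($f(\tau_j)_j$ is defined iff all $\tau_j$ are defined and $[\![f]\!]_M$ is defined at their values) and Horn formulas $\vec x.\phi$ as subsets $[\![\vec x.\phi]\!]_M\subseteq\prod_{i<\alpha}M_{s_i}$, where $R(\tau_j)_j$ and $\tau=\tau'$ require all terms involved to be defined. The sequent $\phi\vdash_{\vec x}\psi$ is valid in $M$ if $[\![\vec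 x.\phi]\!]_M\subseteq[\![\vec x.\psi]\!]_M$. A $\Sigma$-homomorphism $h\colon M\to N$ is a family of total maps $h_s\colon M_s\to N_s$ which preserves the relations and such that, whenever $[\![f]\!]_M(\vec a)$ is defined, $[\![f]\!]_N(h(\vec a))$ is defined and equals $h([\![f]\!]_M(\vec a))$. The category $\mathbf{PMod}\,\mathbb{S}$ consists of the partial $\Sigma$-structures in which all sequents of $\mathbb{S}$ are valid, and all $\Sigma$-homomorphisms between them. *Relative algebras.* An $\mathbb{S}$-relative $\lambda$-ary signature $\Omega$ is a set of operators $\omega$, each equipped with a Horn formula $\mathrm{ar}(\omega)$ over $\Sigma$ in some context and a sort $\mathrm{type}(\omega)$. An $\Omega$-algebra is a partial $\mathbb{S}$-model $A$ with a map $[\![\mathrm{ar}(\omega)]\!]_A\to A_{\mathrm{type}(\omega)}$ for each $\omega\in\Omega$. It is regarded as a partial structure over the signature $\Sigma+\Omega$, in which each $\omega$ is added as a function symbol, and morphisms of $\Omega$-algebras are the $(\Sigma+\Omega)$-homomorphisms. An $\mathbb{S}$-relative $\lambda$-ary judgment is a Horn sequent $\phi\vdash_{\vec x}\psi$ over $\Sigma+\Omega$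 in which $\phi$ is over $\Sigma$. An $\mathbb{S}$-relative $\lambda$-ary algebraic theory $(\Omega,E)$ is such an $\Omega$ together with a set $E$ of such judgments, and $\mathbf{Alg}(\Omega,E)$ is the full subcategory of the category of $\Omega$-algebras on those in which all judgments of $E$ are valid. *Closure.* A monomorphism $m\colon A\to B$ of $\mathbf{Alg}(\Omega,E)$ is $\Sigma$-closed if, for all symbols $f,R$ of $\Sigma$, $\mathrm{Dom}[\![f]\!]_A$ is the preimage under $m$ of $\mathrm{Dom}[\![f]\!]_B$ and $[\![R]\!]_A$ is the preimage under $m$ of $[\![R]\!]_B$; $A$ is then a $\Sigma$-closed subobject of $B$. An object $Y$ is a $U$-retract of $X$ if there are a morphism $p\colon X\to Y$ of $\mathbf{Alg}(\Omega,E)$ and a morphism $s\colon UY\to UX$ of $\mathbf{PMod}\,\mathbb{S}$ with $(Up)\circ s=\mathrm{id}$. -/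

import Mathlib

open CategoryTheory

universe u

namespace RelAlg

/-- A `κ`-ary context over a set `S` of sorts: a family of sorts `(s_i)_{i < α}` with `α < κ`.
An element `len` of `κ.ord.ToType` is an ordinal `α < κ`, and `Set.Iio len` is the set of ordinals
`i < α`. The variables of the context are the indices `i` themselves, the `i`-th one having
sort `s_i`. -/
structure Ctx (S : Type u) (κ : Cardinal.{u}) : Type u where
  len : κ.ord.ToType
  sort : Set.Iio len → S

/-- The set of (indices of) variables of a context. -/
abbrev Ctx.Idx {S : Type u} {κ : Cardinal.{u}} (Γ : Ctx S κ) : Type u := Set.Iio Γ.len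

/-- An `S`-sorted `κ`-ary signature: function symbols `f : ⊓_{i<α} s_i → s` and relation symbols
`R : ⊓_{i<α} s_i` with `α < κ`. -/
structure Signature (S : Type u) (κ : Cardinal.{u}) : Type (u + 1) where
  Fn : Type u
  Rel : Type u
  fnArity : Fn → Ctx S κ
  fnType : Fn → S
  relArity : Rel → Ctx S κ

/-- Terms in the context `Γ`, of type `s`. -/
inductive Term {S : Type u} {κ : Cardinal.{u}} (σ : Signature S κ) (Γ : Ctx S κ) : S → Type u
  | var (i : Γ.Idx) : Term σ Γ (Γ.sort i)
  | app (f : σ.Fn) (args : ∀ j : (σ.fnArity f).Idx, Term σ Γ ((σ.fnArity f).sort j)) :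
      Term σ Γ (σ.fnType f)

/-- `κ`-ary Horn formulas in the context `Γ`: conjunctions are indexed by ordinals `β < κ`. -/
inductive Formula {S : Type u} {κ : Cardinal.{u}} (σ : Signature S κ) (Γ : Ctx S κ) : Type u
  | rel (R : σ.Rel) (args : ∀ j : (σ.relArity R).Idx, Term σ Γ ((σ.relArity R).sort j)) :
      Formula σ Γ
  | eq {s : S} (t t' : Term σ Γ s) : Formula σ Γ
  | top : Formula σ Γ
  | conj (β : κ.ord.ToType) (φ : Set.Iio β → Formula σ Γ) : Formula σ Γ

/-- A Horn sequent `φ ⊢_Γ ψ`. -/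
structure Sequent {S : Type u} {κ : Cardinal.{u}} (σ : Signature S κ) : Type u where
  ctx : Ctx S κ
  lhs : Formula σ ctx
  rhs : Formula σ ctx

/-- A `κ`-ary partial Horn theory over `σ` is a set of Horn sequents over `σ`. -/
abbrev Theory {S : Type u} {κ : Cardinal.{u}} (σ : Signature S κ) : Type u := Set (Sequent σ)

/-- The product `∏_{i<α} M_{s_i}` of an `S`-sorted set along a context. -/
abbrev Ctx.Prod {S : Type u} {κ : Cardinal.{u}} (Γ : Ctx S κ) (M : S → Type u) : Type u :=
  ∀ i : Γ.Idx, M (Γ.sort i)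

/-- Partial `σ`-structures. -/
structure PStr {S : Type u} {κ : Cardinal.{u}} (σ : Signature S κ) : Type (u + 1) where
  carrier : S → Type u
  fn : ∀ f : σ.Fn, (σ.fnArity f).Prod carrier →. carrier (σ.fnType f)
  rel : ∀ R : σ.Rel, Set ((σ.relArity R).Prod carrier)

/-- A family of partial elements as a partial element of the product: it is defined iff all
members of the family are. -/
def partPi {ι : Type u} {X : ι → Type u} (p : ∀ i, Part (X i)) : Part (∀ i, X i) :=
  ⟨∀ i, (p i).Dom, fun h i => (p i).get (h i)⟩

/-- The interpretation of a term: a partial map `∏_{i<α} M_{s_i} ⇀ M_s`. The value of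
`f(τ_j)_j` at `m` is defined iff all `τ_j(m)` are and `f` is defined at `(τ_j(m))_j`. -/
def Term.eval {S : Type u} {κ : Cardinal.{u}} {σ : Signature S κ} {Γ : Ctx S κ}
    (M : PStr σ) (m : Γ.Prod M.carrier) : ∀ {s : S}, Term σ Γ s → Part (M.carrier s)
  | _, .var i => Part.some (m i)
  | _, .app f args =>
      Part.bind (partPi fun j => Term.eval M m (args j)) fun a => M.fn f a

/-- The interpretation of a Horn formula: `φ.Holds M m` says that `m` belongs to the subset
`⟦φ⟧_M` of `∏_{i<α} M_{s_i}`. -/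
def Formula.Holds {S : Type u} {κ : Cardinal.{u}} {σ : Signature S κ} {Γ : Ctx S κ}
    (M : PStr σ) (m : Γ.Prod M.carrier) : Formula σ Γ → Prop
  | .rel R args => ∃ a, a ∈ partPi (fun j => (args j).eval M m) ∧ a ∈ M.rel R
  | .eq t t' => ∃ a, a ∈ t.eval M m ∧ a ∈ t'.eval M m
  | .top => True
  | .conj _ φ => ∀ j, (φ j).Holds M m

/-- Validity of a Horn sequent in a partial structure. -/
def Sequent.Valid {S : Type u} {κ : Cardinal.{u}} {σ : Signature S κ} (q : Sequent σ)
    (M : PStr σ) : Prop :=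
  ∀ m : q.ctx.Prod M.carrier, q.lhs.Holds M m → q.rhs.Holds M m

/-- `σ`-homomorphisms: sorted total maps that preserve definedness and values of the partial
functions, and the relations. -/
@[ext]
structure PStr.Hom {S : Type u} {κ : Cardinal.{u}} {σ : Signature S κ} (M N : PStr σ) :
    Type u where
  map : ∀ s, M.carrier s → N.carrier s
  map_fn : ∀ (f : σ.Fn) (a : (σ.fnArity f).Prod M.carrier) (b : M.carrier (σ.fnType f)),
    b ∈ M.fn f a → map _ b ∈ N.fn f (fun i => map _ (a i))
  map_rel : ∀ (R : σ.Rel) (a : (σ.relArity R).Prod M.carrier),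
    a ∈ M.rel R → (fun i => map _ (a i)) ∈ N.rel R

instance PStr.category {S : Type u} {κ : Cardinal.{u}} (σ : Signature S κ) :
    Category.{u} (PStr σ) where
  Hom := PStr.Hom
  id M := ⟨fun _ a => a, fun _ _ _ h => h, fun _ _ h => h⟩
  comp f g := ⟨fun s a => g.map s (f.map s a), fun F a b h => g.map_fn F _ _ (f.map_fn F a b h),
    fun R a h => g.map_rel R _ (f.map_rel R a h)⟩

/-- The full subcategory of partial models of a partial Horn theory. -/
abbrev isModel {S : Type u} {κ : Cardinal.{u}} {σ : Signature S κ} (T : Theory σ) :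
    ObjectProperty (PStr σ) := fun M => ∀ q ∈ T, q.Valid M

/-- The category of partial `T`-models. -/
abbrev PMod {S : Type u} {κ : Cardinal.{u}} {σ : Signature S κ} (T : Theory σ) : Type (u + 1) :=
  (isModel T).FullSubcategory

/-- The condition on a monomorphism of partial structures to be `σ`-closed: for each function
symbol `f`, `Dom f_M` is the preimage of `Dom f_N`, and for each relation symbol `R`, `R_M` is the
preimage of `R_N`. -/
def IsClosedHom {S : Type u} {κ : Cardinal.{u}} {σ : Signature S κ} {M N : PStr σ}
    (h : M ⟶ N) : Prop :=
  (∀ (f : σ.Fn) (a : (σ.fnArity f).Prod M.carrier),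
    (M.fn f a).Dom ↔ (N.fn f (fun i => h.map _ (a i))).Dom) ∧
  (∀ (R : σ.Rel) (a : (σ.relArity R).Prod M.carrier),
    a ∈ M.rel R ↔ (fun i => h.map _ (a i)) ∈ N.rel R)

/-- A relative signature: a set of operators, each having as arity a Horn formula over `σ` (in
the context `arityCtx`) and as type a sort. -/
structure RelSignature {S : Type u} {κ : Cardinal.{u}} (σ : Signature S κ) : Type (u + 1) where
  Op : Type u
  arityCtx : Op → Ctx S κ
  arity : ∀ ω : Op, Formula σ (arityCtx ω)
  type : Op → S

/-- The signature `Σ + Ω`. -/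
def RelSignature.total {S : Type u} {κ : Cardinal.{u}} {σ : Signature S κ}
    (Ω : RelSignature σ) : Signature S κ where
  Fn := σ.Fn ⊕ Ω.Op
  Rel := σ.Rel
  fnArity := Sum.elim σ.fnArity Ω.arityCtx
  fnType := Sum.elim σ.fnType Ω.type
  relArity := σ.relArity

/-- A term over `Σ`, regarded as a term over `Σ + Ω`. -/
def Term.lift {S : Type u} {κ : Cardinal.{u}} {σ : Signature S κ} (Ω : RelSignature σ)
    {Γ : Ctx S κ} : ∀ {s : S}, Term σ Γ s → Term Ω.total Γ s
  | _, .var i => .var i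
  | _, .app f args => Term.app (σ := Ω.total) (Sum.inl f) (fun j => (args j).lift Ω)

/-- A Horn formula over `Σ`, regarded as a Horn formula over `Σ + Ω`. -/
def Formula.lift {S : Type u} {κ : Cardinal.{u}} {σ : Signature S κ} (Ω : RelSignature σ)
    {Γ : Ctx S κ} : Formula σ Γ → Formula Ω.total Γ
  | .rel R args => Formula.rel (σ := Ω.total) R (fun j => (args j).lift Ω)
  | .eq t t' => .eq (t.lift Ω) (t'.lift Ω)
  | .top => .top
  | .conj β φ => .conj β (fun j => (φ j).lift Ω)

/-- A relative judgment: a Horn sequent over `Σ + Ω` whose left-hand side is over `Σ`. -/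
structure Judgment {S : Type u} {κ : Cardinal.{u}} {σ : Signature S κ} (Ω : RelSignature σ) :
    Type u where
  ctx : Ctx S κ
  lhs : Formula σ ctx
  rhs : Formula Ω.total ctx

/-- The Horn sequent over `Σ + Ω` underlying a relative judgment. -/
def Judgment.toSequent {S : Type u} {κ : Cardinal.{u}} {σ : Signature S κ} {Ω : RelSignature σ}
    (J : Judgment Ω) : Sequent Ω.total :=
  ⟨J.ctx, J.lhs.lift Ω, J.rhs⟩

/-- An `Ω`-algebra: a partial model `A` together with, for each operator `ω`, a (total) map
`⟦ar ω⟧_A → A_{type ω}`. -/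
structure Algebra {S : Type u} {κ : Cardinal.{u}} {σ : Signature S κ} (T : Theory σ)
    (Ω : RelSignature σ) : Type (u + 1) where
  model : PMod T
  op : ∀ ω : Ω.Op, {m : (Ω.arityCtx ω).Prod model.obj.carrier // (Ω.arity ω).Holds model.obj m} →
    model.obj.carrier (Ω.type ω)

/-- An `Ω`-algebra, regarded as a partial `(Σ + Ω)`-structure. -/
def Algebra.toPStr {S : Type u} {κ : Cardinal.{u}} {σ : Signature S κ} {T : Theory σ}
    {Ω : RelSignature σ} (A : Algebra T Ω) : PStr Ω.total where
  carrier := A.model.obj.carrier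
  fn
    | .inl f => A.model.obj.fn f
    | .inr ω => fun m => ⟨(Ω.arity ω).Holds A.model.obj m, fun h => A.op ω ⟨m, h⟩⟩
  rel := A.model.obj.rel

/-- The category `Alg Ω`: its morphisms are the `(Σ + Ω)`-homomorphisms. -/
instance Algebra.category {S : Type u} {κ : Cardinal.{u}} {σ : Signature S κ} (T : Theory σ)
    (Ω : RelSignature σ) : Category.{u} (Algebra T Ω) where
  Hom A B := A.toPStr ⟶ B.toPStr
  id A := 𝟙 A.toPStr
  comp {A B C} f g := (f ≫ g : A.toPStr ⟶ C.toPStr)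

/-- The algebras that satisfy all the judgments in `E`. -/
def satisfies {S : Type u} {κ : Cardinal.{u}} {σ : Signature S κ} (T : Theory σ)
    {Ω : RelSignature σ} (E : Set (Judgment Ω)) : ObjectProperty (Algebra T Ω) :=
  fun A => ∀ J ∈ E, J.toSequent.Valid A.toPStr

/-- The category `Alg (Ω, E)`, a full subcategory of `Alg Ω`. -/
abbrev Alg {S : Type u} {κ : Cardinal.{u}} {σ : Signature S κ} (T : Theory σ)
    {Ω : RelSignature σ} (E : Set (Judgment Ω)) : Type (u + 1) :=
  (satisfies T E).FullSubcategory

/-- The `Σ`-homomorphism underlying a morphism of `Ω`-algebras. -/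
def Algebra.homModel {S : Type u} {κ : Cardinal.{u}} {σ : Signature S κ} {T : Theory σ}
    {Ω : RelSignature σ} {A B : Algebra T Ω} (h : A ⟶ B) : A.model.obj ⟶ B.model.obj :=
  let h' : A.toPStr.Hom B.toPStr := h
  { map := h'.map
    map_fn := fun f => h'.map_fn (Sum.inl f)
    map_rel := h'.map_rel }

/-- The forgetful functor `U : Alg (Ω, E) ⥤ PMod T`. -/
def forget {S : Type u} {κ : Cardinal.{u}} {σ : Signature S κ} (T : Theory σ)
    {Ω : RelSignature σ} (E : Set (Judgment Ω)) : Alg T E ⥤ PMod T where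
  obj A := A.obj.model
  map h := ObjectProperty.homMk (Algebra.homModel h.hom)
  map_id _ := rfl
  map_comp _ _ := rfl

/-- A full subcategory of `Alg (Ω, E)` is definable by relative judgments if it is
`Alg (Ω, E ∪ E')` for a set `E'` of relative judgments. -/
def IsDefinable {S : Type u} {κ : Cardinal.{u}} {σ : Signature S κ} {T : Theory σ}
    {Ω : RelSignature σ} {E : Set (Judgment Ω)} (P : ObjectProperty (Alg T E)) : Prop :=
  ∃ E' : Set (Judgment Ω), ∀ A : Alg T E, P A ↔ satisfies T (E ∪ E') A.obj

/-- Closure under `Σ`-closed subobjects. -/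
def ClosedUnderClosedSubobjects {S : Type u} {κ : Cardinal.{u}} {σ : Signature S κ}
    {T : Theory σ} {Ω : RelSignature σ} {E : Set (Judgment Ω)}
    (P : ObjectProperty (Alg T E)) : Prop :=
  ∀ ⦃A B : Alg T E⦄ (m : A ⟶ B), Mono m → IsClosedHom ((forget T E).map m).hom → P B → P A

/-- For a functor `U`, closure under `U`-retracts: if `f : X ⟶ Y` is such that `U f` is a
retraction (has a section) and `X` has the property `P`, then `Y` has it. -/
def ClosedUnderRetractsAlong {C : Type*} [Category* C] {D : Type*} [Category* D] (U : C ⥤ D)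
    (P : ObjectProperty C) : Prop :=
  ∀ ⦃X Y : C⦄ (f : X ⟶ Y), IsSplitEpi (U.map f) → P X → P Y

end RelAlg

/-! From definability to closure: validity of an arbitrary Horn sequent over `Σ + Ω` passes to
products, closed substructures and `κ`-filtered colimits, because the truth of a Horn formula there
is controlled by its truth in the given structures. Only `U`-retracts need the shape of a judgment.
The section respects `Σ` alone, which is enough to carry the premise up; the retraction respects `Ω`
as well and carries the conclusion down.

For the converse, let `A` validate every judgment valid throughout the class `P`. Describe `U A` by
its pieces of diagram: fewer than `κ` elements together with a Horn formula over `Σ` true of them.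
As `κ` is regular, these pieces are `κ`-directed. Each piece `D` has a generic algebra in `P`
(`exists_isGeneric`): choose one counterexample in `P` for every formula over `Σ + Ω` that `D` does
not imply in `P`, form the product, and take the closed subalgebra generated by the resulting tuple.
If `ψ` is true of the generators, then `D ⊢ ψ` is a judgment valid in `P`, hence in `A`; so sending
generators to the elements they name extends to a homomorphism into `A` (`IsGeneric.exists_hom`).
The same argument yields transition maps between generic algebras.

The colimit of these algebras lies in `P` and maps to `A`. An element of `A` names an element of the
colimit, independently of the piece used, and every `Σ`-fact about `A` is recorded in some piece.
Naming is therefore a `Σ`-homomorphic section, and `A` is a `U`-retract of the colimit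
(`prop_of_forall_valid`). -/

namespace RelAlg

open Limits

/-! ### Horn logic in partial structures and its preservation properties. -/

section Structures

variable {S : Type u} {κ : Cardinal.{u}} {τ : Signature S κ} {Γ : Ctx S κ}

theorem mem_partPi {ι : Type u} {X : ι → Type u} {p : ∀ i, Part (X i)} {a : ∀ i, X i} :
    a ∈ partPi p ↔ ∀ i, a i ∈ p i := by
  constructor
  · rintro ⟨h, rfl⟩ i
    exact ⟨h i, rfl⟩
  · intro h
    exact ⟨fun i => (h i).1, funext fun i => (h i).2⟩

theorem mem_eval_var {M : PStr τ} {m : Γ.Prod M.carrier} {i : Γ.Idx}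
    {b : M.carrier (Γ.sort i)} : b ∈ (Term.var (σ := τ) i).eval M m ↔ b = m i := by
  simp [Term.eval]

theorem mem_eval_app {M : PStr τ} {m : Γ.Prod M.carrier} {f : τ.Fn}
    {args : ∀ j : (τ.fnArity f).Idx, Term τ Γ ((τ.fnArity f).sort j)}
    {b : M.carrier (τ.fnType f)} :
    b ∈ (Term.app f args).eval M m ↔
      ∃ a : (τ.fnArity f).Prod M.carrier, (∀ j, a j ∈ (args j).eval M m) ∧ b ∈ M.fn f a := by
  simp only [Term.eval, Part.mem_bind_iff, mem_partPi]

theorem holds_rel {M : PStr τ} {m : Γ.Prod M.carrier} {R : τ.Rel}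
    {args : ∀ j : (τ.relArity R).Idx, Term τ Γ ((τ.relArity R).sort j)} :
    (Formula.rel R args).Holds M m ↔
      ∃ a : (τ.relArity R).Prod M.carrier, (∀ j, a j ∈ (args j).eval M m) ∧ a ∈ M.rel R := by
  simp only [Formula.Holds, mem_partPi]

theorem holds_eq {M : PStr τ} {m : Γ.Prod M.carrier} {s : S} {t t' : Term τ Γ s} :
    (Formula.eq t t').Holds M m ↔ ∃ a, a ∈ t.eval M m ∧ a ∈ t'.eval M m := by
  simp only [Formula.Holds]

theorem holds_eq_self {M : PStr τ} {m : Γ.Prod M.carrier} {s : S} {t : Term τ Γ s} :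
    (Formula.eq t t).Holds M m ↔ (t.eval M m).Dom := by
  simp only [Formula.Holds, and_self, Part.dom_iff_mem]

theorem holds_conj {M : PStr τ} {m : Γ.Prod M.carrier} {β : κ.ord.ToType}
    {φ : Set.Iio β → Formula τ Γ} :
    (Formula.conj β φ).Holds M m ↔ ∀ j, (φ j).Holds M m := by
  simp only [Formula.Holds]

/-! ### Homomorphisms and closed embeddings -/

section Hom

variable {M N : PStr τ}

theorem PStr.Hom.map_eval (h : PStr.Hom M N) {m : Γ.Prod M.carrier} {s : S} {t : Term τ Γ s}
    {b : M.carrier s} (hb : b ∈ t.eval M m) : h.map s b ∈ t.eval N fun i => h.map _ (m i) := by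
  induction t with
  | var i => rw [mem_eval_var] at hb ⊢; rw [hb]
  | app f args ih =>
    obtain ⟨a, ha, hb⟩ := mem_eval_app.1 hb
    exact mem_eval_app.2 ⟨_, fun j => ih j (ha j), h.map_fn f a b hb⟩

theorem PStr.Hom.map_holds (h : PStr.Hom M N) {m : Γ.Prod M.carrier} {φ : Formula τ Γ}
    (hφ : φ.Holds M m) : φ.Holds N fun i => h.map _ (m i) := by
  induction φ with
  | rel R args =>
    obtain ⟨a, ha, hR⟩ := holds_rel.1 hφ
    exact holds_rel.2 ⟨_, fun j => h.map_eval (ha j), h.map_rel R a hR⟩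
  | eq t t' =>
    obtain ⟨a, ha, ha'⟩ := holds_eq.1 hφ
    exact holds_eq.2 ⟨_, h.map_eval ha, h.map_eval ha'⟩
  | top => trivial
  | conj β φ ih => exact holds_conj.2 fun j => ih j (holds_conj.1 hφ j)

/-- A homomorphism is a closed embedding if it is injective and closed. -/
structure IsClosedEmb (h : M ⟶ N) : Prop where
  closed : IsClosedHom h
  inj : ∀ s, Function.Injective (h.map s)

/-- Closedness pulls definedness back one function symbol at a time, so induction on the term
suffices. Injectivity is needed only later, to reflect equations. -/
theorem IsClosedHom.exists_mem_eval {h : M ⟶ N} (hc : IsClosedHom h) {m : Γ.Prod M.carrier}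
    {s : S} {t : Term τ Γ s} {c : N.carrier s} (hb : c ∈ t.eval N fun i => h.map _ (m i)) :
    ∃ b ∈ t.eval M m, h.map s b = c := by
  induction t with
  | var i => exact ⟨m i, mem_eval_var.2 rfl, (mem_eval_var.1 hb).symm⟩
  | app f args ih =>
    obtain ⟨a, ha, hb⟩ := mem_eval_app.1 hb
    choose b hb' hba using fun j => ih j (ha j)
    obtain rfl : (fun j => h.map _ (b j)) = a := funext hba
    have hd : (M.fn f b).Dom := (hc.1 f b).2 hb.1
    exact ⟨(M.fn f b).get hd, mem_eval_app.2 ⟨b, hb', Part.get_mem hd⟩,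
      Part.mem_unique (h.map_fn f b _ (Part.get_mem hd)) hb⟩

theorem IsClosedEmb.holds_iff {h : M ⟶ N} (hc : IsClosedEmb h) {m : Γ.Prod M.carrier}
    {φ : Formula τ Γ} : (φ.Holds N fun i => h.map _ (m i)) ↔ φ.Holds M m := by
  refine ⟨fun hφ => ?_, PStr.Hom.map_holds h⟩
  induction φ with
  | rel R args =>
    obtain ⟨a, ha, hR⟩ := holds_rel.1 hφ
    choose b hb hba using fun j => hc.closed.exists_mem_eval (ha j)
    obtain rfl : (fun j => h.map _ (b j)) = a := funext hba
    exact holds_rel.2 ⟨b, hb, (hc.closed.2 R b).2 hR⟩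
  | eq t t' =>
    obtain ⟨a, ha, ha'⟩ := holds_eq.1 hφ
    obtain ⟨b, hb, rfl⟩ := hc.closed.exists_mem_eval ha
    obtain ⟨b', hb', hbb⟩ := hc.closed.exists_mem_eval ha'
    obtain rfl := hc.inj _ hbb
    exact holds_eq.2 ⟨_, hb, hb'⟩
  | top => trivial
  | conj β φ ih => exact holds_conj.2 fun j => ih j (holds_conj.1 hφ j)

theorem Sequent.Valid.of_isClosedEmb {h : M ⟶ N} (hc : IsClosedEmb h) {q : Sequent τ}
    (hq : q.Valid N) : q.Valid M := fun _ hm =>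
  hc.holds_iff.1 (hq _ (PStr.Hom.map_holds h hm))

theorem Sequent.Valid.of_retract (r : M ⟶ N) (i : N ⟶ M) (hi : i ≫ r = 𝟙 N) {q : Sequent τ}
    (hq : q.Valid M) : q.Valid N := fun m hm => by
  have h := PStr.Hom.map_holds r (hq _ (PStr.Hom.map_holds i hm))
  have e : (fun k => r.map _ (i.map _ (m k))) = m :=
    funext fun k => congrArg (fun g : N ⟶ N => g.map _ (m k)) hi
  rwa [e] at h

end Hom

/-! ### Products -/

section Pi

variable {J : Type u} (M : J → PStr τ)

/-- The product of partial structures. -/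
def PStr.pi : PStr τ where
  carrier s := ∀ j, (M j).carrier s
  fn f a := partPi fun j => (M j).fn f fun i => a i j
  rel R := {a | ∀ j, (fun i => a i j) ∈ (M j).rel R}

/-- The projections of a product. -/
def PStr.piProj (j : J) : PStr.pi M ⟶ M j :=
  PStr.Hom.mk (fun _ a => a j) (fun _ _ _ h => mem_partPi.1 h j) (fun _ _ h => h j)

variable {M}

/-- The homomorphism to a product with given components. -/
def PStr.piLift {N : PStr τ} (h : ∀ j, N ⟶ M j) : N ⟶ PStr.pi M :=
  PStr.Hom.mk (fun s a j => (h j).map s a)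
    (fun f a b hb => mem_partPi.2 fun j => (h j).map_fn f a b hb)
    (fun R a ha j => (h j).map_rel R a ha)

theorem mem_eval_pi {m : Γ.Prod (PStr.pi M).carrier} {s : S} {t : Term τ Γ s}
    {b : (PStr.pi M).carrier s} :
    b ∈ t.eval (PStr.pi M) m ↔ ∀ j, b j ∈ t.eval (M j) fun i => m i j := by
  refine ⟨fun h j => PStr.Hom.map_eval (PStr.piProj M j) h, fun h => ?_⟩
  induction t with
  | var i => exact mem_eval_var.2 (funext fun j => mem_eval_var.1 (h j))
  | app f args ih =>
    choose a ha hb using fun j => mem_eval_app.1 (h j)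
    exact mem_eval_app.2 ⟨fun i j => a j i, fun i => ih i fun j => ha j i, mem_partPi.2 hb⟩

theorem holds_pi {m : Γ.Prod (PStr.pi M).carrier} {φ : Formula τ Γ} :
    φ.Holds (PStr.pi M) m ↔ ∀ j, φ.Holds (M j) fun i => m i j := by
  refine ⟨fun h j => PStr.Hom.map_holds (PStr.piProj M j) h, fun h => ?_⟩
  induction φ with
  | rel R args =>
    choose a ha hR using fun j => holds_rel.1 (h j)
    exact holds_rel.2 ⟨fun i j => a j i, fun i => mem_eval_pi.2 fun j => ha j i, hR⟩
  | eq t t' =>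
    choose a ha ha' using fun j => holds_eq.1 (h j)
    exact holds_eq.2 ⟨a, mem_eval_pi.2 ha, mem_eval_pi.2 ha'⟩
  | top => trivial
  | conj β φ ih => exact holds_conj.2 fun k => ih k fun j => holds_conj.1 (h j) k

theorem Sequent.Valid.pi {q : Sequent τ} (h : ∀ j, q.Valid (M j)) : q.Valid (PStr.pi M) :=
  fun _ hm => holds_pi.2 fun j => h j _ (holds_pi.1 hm j)

end Pi

/-! ### Kernel pairs -/

section Ker

variable {M N : PStr τ} (h : M ⟶ N)

/-- The kernel pair of a homomorphism. -/
def PStr.ker : PStr τ where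
  carrier s := {p : M.carrier s × M.carrier s // h.map s p.1 = h.map s p.2}
  fn f a := ⟨(M.fn f fun i => (a i).1.1).Dom ∧ (M.fn f fun i => (a i).1.2).Dom, fun d =>
    ⟨((M.fn f _).get d.1, (M.fn f _).get d.2), by
      have h₁ := h.map_fn f _ _ (Part.get_mem d.1)
      have h₂ := h.map_fn f _ _ (Part.get_mem d.2)
      rw [← funext fun i => (a i).2] at h₂
      exact Part.mem_unique h₁ h₂⟩⟩
  rel R := {a | (fun i => (a i).1.1) ∈ M.rel R ∧ (fun i => (a i).1.2) ∈ M.rel R}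

variable {h} in
theorem PStr.mem_ker_fn {f : τ.Fn} {a : (τ.fnArity f).Prod (PStr.ker h).carrier}
    {b : (PStr.ker h).carrier (τ.fnType f)} : b ∈ (PStr.ker h).fn f a ↔
      b.1.1 ∈ M.fn f (fun i => (a i).1.1) ∧ b.1.2 ∈ M.fn f (fun i => (a i).1.2) := by
  constructor
  · rintro ⟨d, rfl⟩
    exact ⟨Part.get_mem d.1, Part.get_mem d.2⟩
  · rintro ⟨⟨d₁, h₁⟩, ⟨d₂, h₂⟩⟩
    exact ⟨⟨d₁, d₂⟩, Subtype.ext (Prod.ext h₁ h₂)⟩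

/-- The first projection of a kernel pair. -/
def PStr.kerFst : PStr.ker h ⟶ M :=
  PStr.Hom.mk (fun _ p => p.1.1) (fun _ _ _ hb => (PStr.mem_ker_fn.1 hb).1) (fun _ _ ha => ha.1)

/-- The second projection of a kernel pair. -/
def PStr.kerSnd : PStr.ker h ⟶ M :=
  PStr.Hom.mk (fun _ p => p.1.2) (fun _ _ _ hb => (PStr.mem_ker_fn.1 hb).2) (fun _ _ ha => ha.2)

theorem PStr.kerFst_comp : PStr.kerFst h ≫ h = PStr.kerSnd h ≫ h :=
  PStr.Hom.ext (funext fun _ => funext fun p => p.2)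

variable {h}

theorem mem_eval_ker {m : Γ.Prod (PStr.ker h).carrier} {s : S} {t : Term τ Γ s}
    {b : (PStr.ker h).carrier s} (h₁ : b.1.1 ∈ t.eval M fun i => (m i).1.1)
    (h₂ : b.1.2 ∈ t.eval M fun i => (m i).1.2) : b ∈ t.eval (PStr.ker h) m := by
  induction t with
  | var i =>
    exact mem_eval_var.2 (Subtype.ext (Prod.ext (mem_eval_var.1 h₁) (mem_eval_var.1 h₂)))
  | app f args ih =>
    obtain ⟨a, ha, hb⟩ := mem_eval_app.1 h₁
    obtain ⟨a', ha', hb'⟩ := mem_eval_app.1 h₂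
    have e : ∀ i, h.map _ (a i) = h.map _ (a' i) := fun i => by
      have k₁ := PStr.Hom.map_eval h (ha i)
      have k₂ := PStr.Hom.map_eval h (ha' i)
      rw [← funext fun k => (m k).2] at k₂
      exact Part.mem_unique k₁ k₂
    exact mem_eval_app.2 ⟨fun i => ⟨(a i, a' i), e i⟩, fun i => ih i (ha i) (ha' i),
      PStr.mem_ker_fn.2 ⟨hb, hb'⟩⟩

theorem eq_of_mem_eval_ker {m : Γ.Prod (PStr.ker h).carrier} {s : S} {t : Term τ Γ s}
    {a b : M.carrier s} (h₁ : a ∈ t.eval M fun i => (m i).1.1)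
    (h₂ : b ∈ t.eval M fun i => (m i).1.2) : h.map s a = h.map s b := by
  have k₁ := PStr.Hom.map_eval h h₁
  have k₂ := PStr.Hom.map_eval h h₂
  rw [← funext fun k => (m k).2] at k₂
  exact Part.mem_unique k₁ k₂

/-- Witnesses for the two coordinates pair up because both are sent by `h` to the value of the same
term at the same tuple. Consequently the kernel pair of a morphism of algebras is again an algebra.
-/
theorem holds_ker {m : Γ.Prod (PStr.ker h).carrier} {φ : Formula τ Γ}
    (h₁ : φ.Holds M fun i => (m i).1.1) (h₂ : φ.Holds M fun i => (m i).1.2) :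
    φ.Holds (PStr.ker h) m := by
  induction φ with
  | rel R args =>
    obtain ⟨a, ha, hR⟩ := holds_rel.1 h₁
    obtain ⟨a', ha', hR'⟩ := holds_rel.1 h₂
    exact holds_rel.2 ⟨fun i => ⟨(a i, a' i), eq_of_mem_eval_ker (ha i) (ha' i)⟩,
      fun i => mem_eval_ker (ha i) (ha' i), hR, hR'⟩
  | eq t t' =>
    obtain ⟨a, ha, hb⟩ := holds_eq.1 h₁
    obtain ⟨a', ha', hb'⟩ := holds_eq.1 h₂
    exact holds_eq.2 ⟨⟨(a, a'), eq_of_mem_eval_ker ha ha'⟩, mem_eval_ker ha ha',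
      mem_eval_ker hb hb'⟩
  | top => trivial
  | conj β φ ih => exact holds_conj.2 fun j => ih j (holds_conj.1 h₁ j) (holds_conj.1 h₂ j)

theorem Sequent.Valid.ker {q : Sequent τ} (hq : q.Valid M) : q.Valid (PStr.ker h) := fun _ hm =>
  holds_ker (hq _ (PStr.Hom.map_holds (PStr.kerFst h) hm))
    (hq _ (PStr.Hom.map_holds (PStr.kerSnd h) hm))

end Ker

/-! ### Generated substructures -/

section Span

variable (N : PStr τ) (m : Γ.Prod N.carrier)

/-- The closed substructure generated by a family of elements. -/
def PStr.span : PStr τ where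
  carrier s := {b : N.carrier s // ∃ t : Term τ Γ s, b ∈ t.eval N m}
  fn f a := ⟨(N.fn f fun i => (a i).1).Dom, fun d => ⟨(N.fn f _).get d, by
    choose t ht using fun i => (a i).2
    exact ⟨Term.app f t, mem_eval_app.2 ⟨_, ht, Part.get_mem d⟩⟩⟩⟩
  rel R := {a | (fun i => (a i).1) ∈ N.rel R}

/-- The inclusion of a generated substructure. -/
def PStr.spanIncl : PStr.span N m ⟶ N :=
  PStr.Hom.mk (fun _ b => b.1) (fun f a b => by rintro ⟨d, rfl⟩; exact ⟨d, rfl⟩)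
    (fun _ _ h => h)

theorem PStr.isClosedEmb_spanIncl : IsClosedEmb (PStr.spanIncl N m) :=
  ⟨⟨fun _ _ => Iff.rfl, fun _ _ => Iff.rfl⟩, fun _ _ _ h => Subtype.ext h⟩

/-- The generators of a generated substructure. -/
def PStr.spanGen : Γ.Prod (PStr.span N m).carrier :=
  fun i => ⟨m i, Term.var i, mem_eval_var.2 rfl⟩

/-- The elements `m` generate `N`. -/
def PStr.Generates : Prop :=
  ∀ s (b : N.carrier s), ∃ t : Term τ Γ s, b ∈ t.eval N m

theorem PStr.generates_spanGen : (PStr.span N m).Generates (PStr.spanGen N m) := by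
  rintro s ⟨b, t, hb⟩
  obtain ⟨b', hb', e⟩ := (PStr.isClosedEmb_spanIncl N m).closed.exists_mem_eval
    (m := PStr.spanGen N m) hb
  obtain rfl : b' = ⟨b, t, hb⟩ := Subtype.ext e
  exact ⟨t, hb'⟩

variable {N m}

theorem PStr.Generates.hom_ext (hg : N.Generates m) {C : PStr τ} {g h : N ⟶ C}
    (e : ∀ i, g.map _ (m i) = h.map _ (m i)) : g = h := by
  refine PStr.Hom.ext (funext fun s => funext fun b => ?_)
  obtain ⟨t, ht⟩ := hg s b
  have k₁ := PStr.Hom.map_eval g ht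
  have k₂ := PStr.Hom.map_eval h ht
  rw [← funext e] at k₂
  exact Part.mem_unique k₁ k₂

/-- Every element of `N` is the value of some term; send it to the value of that term at `c`.
Definedness of the latter (the formula `t = t`), independence of the term, and preservation of
functions and relations are all instances of `hc`. -/
theorem PStr.Generates.exists_hom (hg : N.Generates m) {C : PStr τ} (c : Γ.Prod C.carrier)
    (hc : ∀ ψ : Formula τ Γ, ψ.Holds N m → ψ.Holds C c) :
    ∃ h : N ⟶ C, ∀ i, h.map _ (m i) = c i := by
  choose t ht using hg
  have key : ∀ {s} (t t' : Term τ Γ s) {b}, b ∈ t.eval N m → b ∈ t'.eval N m →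
      ∃ d, d ∈ t.eval C c ∧ d ∈ t'.eval C c :=
    fun t t' b h h' => holds_eq.1 (hc (.eq t t') (holds_eq.2 ⟨b, h, h'⟩))
  choose v hv hv' using fun s b => key (t s b) (t s b) (ht s b) (ht s b)
  have hval : ∀ {s} (t' : Term τ Γ s) {b}, b ∈ t'.eval N m → v s b ∈ t'.eval C c := by
    intro s t' b h
    obtain ⟨d, hd, hd'⟩ := key (t s b) t' (ht s b) h
    rwa [Part.mem_unique (hv s b) hd]
  refine ⟨PStr.Hom.mk v (fun f a b hb => ?_) (fun R a ha => ?_), fun i => ?_⟩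
  · obtain ⟨a', ha', hb'⟩ := mem_eval_app.1 (hval (.app f fun i => t _ (a i))
      (mem_eval_app.2 ⟨a, fun i => ht _ (a i), hb⟩))
    rwa [← funext fun i => Part.mem_unique (ha' i) (hv _ (a i))]
  · obtain ⟨a', ha', hb'⟩ := holds_rel.1 (hc (.rel R fun i => t _ (a i))
      (holds_rel.2 ⟨a, fun i => ht _ (a i), ha⟩))
    rwa [← funext fun i => Part.mem_unique (ha' i) (hv _ (a i))]
  · exact mem_eval_var.1 (hval (.var i) (mem_eval_var.2 rfl))

end Span

/-! ### Substitution of terms for variables -/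

section Subst

variable {Δ : Ctx S κ}

/-- Substitution in terms. -/
def Term.subst (θ : ∀ i : Γ.Idx, Term τ Δ (Γ.sort i)) : ∀ {s : S}, Term τ Γ s → Term τ Δ s
  | _, .var i => θ i
  | _, .app f args => .app f fun j => (args j).subst θ

/-- Substitution in Horn formulas. -/
def Formula.subst (θ : ∀ i : Γ.Idx, Term τ Δ (Γ.sort i)) : Formula τ Γ → Formula τ Δ
  | .rel R args => .rel R fun j => (args j).subst θ
  | .eq t t' => .eq (t.subst θ) (t'.subst θ)
  | .top => .top
  | .conj β φ => .conj β fun j => (φ j).subst θ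

variable {θ : ∀ i : Γ.Idx, Term τ Δ (Γ.sort i)} {M : PStr τ} {m : Γ.Prod M.carrier}
  {n : Δ.Prod M.carrier}

theorem Term.eval_subst (h : ∀ i, (θ i).eval M n = Part.some (m i)) {s : S} (t : Term τ Γ s) :
    (t.subst θ).eval M n = t.eval M m := by
  induction t with
  | var i => exact h i
  | app f args ih => simp only [Term.subst, Term.eval, ih]

theorem Formula.holds_subst (h : ∀ i, (θ i).eval M n = Part.some (m i)) (φ : Formula τ Γ) :
    (φ.subst θ).Holds M n ↔ φ.Holds M m := by
  induction φ with
  | rel R args => simp only [Formula.subst, Formula.Holds, Term.eval_subst h]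
  | eq t t' => simp only [Formula.subst, Formula.Holds, Term.eval_subst h]
  | top => exact Iff.rfl
  | conj β φ ih => simp only [Formula.subst, Formula.Holds, ih]

end Subst

end Structures

/-! ### Concrete `κ`-filtered colimits of partial structures. -/

section FilteredColimits

variable {S : Type u} {κ : Cardinal.{u}}

theorem mk_Iio_lt (β : κ.ord.ToType) : Cardinal.mk (Set.Iio β) < κ := by
  simpa using Cardinal.mk_Iio_lt β

theorem hasCardinalLT_Iio (β : κ.ord.ToType) : HasCardinalLT (Set.Iio β) κ :=
  hasCardinalLT_iff_cardinal_mk_lt _ _ |>.2 (mk_Iio_lt β)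

variable {τ : Signature S κ} {Γ : Ctx S κ} {J : Type u} [SmallCategory J] (F : J ⥤ PStr τ)

theorem map_map_apply {i j k : J} (f : i ⟶ j) (g : j ⟶ k) {s : S} (x : (F.obj i).carrier s) :
    (F.map g).map s ((F.map f).map s x) = (F.map (f ≫ g)).map s x := by
  rw [F.map_comp]; rfl

variable [Fact κ.IsRegular] [IsCardinalFiltered J κ]

/-- Two elements of a filtered diagram are identified if they become equal at some later stage. -/
def colimSetoid (s : S) : Setoid (Σ j, (F.obj j).carrier s) where
  r x y := ∃ (k : J) (f : x.1 ⟶ k) (g : y.1 ⟶ k), (F.map f).map s x.2 = (F.map g).map s y.2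
  iseqv := by
    refine ⟨fun x => ⟨x.1, 𝟙 _, 𝟙 _, rfl⟩, fun ⟨k, f, g, h⟩ => ⟨k, g, f, h.symm⟩, ?_⟩
    rintro x y z ⟨k, f, g, h⟩ ⟨l, f', g', h'⟩
    have := isFiltered_of_isCardinalFiltered J κ
    obtain ⟨n, a, b, hab⟩ := IsFiltered.span g f'
    refine ⟨n, f ≫ a, g' ≫ b, ?_⟩
    rw [← map_map_apply, ← map_map_apply, h, ← h', map_map_apply, map_map_apply, hab]

/-- The carriers of the colimit of a filtered diagram. -/
abbrev ColimCarrier (s : S) : Type u := Quotient (colimSetoid F s)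

/-- The coprojections to the colimit of a filtered diagram. -/
def colimMk {s : S} (j : J) (x : (F.obj j).carrier s) : ColimCarrier F s :=
  Quotient.mk _ ⟨j, x⟩

variable {F}

theorem colimMk_map {s : S} {j k : J} (g : j ⟶ k) (x : (F.obj j).carrier s) :
    colimMk F k ((F.map g).map s x) = colimMk F j x :=
  Quotient.sound ⟨k, 𝟙 k, g, by rw [map_map_apply, Category.comp_id]⟩

theorem exists_map_eq {ι : Type u} (hι : HasCardinalLT ι κ) {srt : ι → S} {j k : J}
    (x : ∀ i, (F.obj j).carrier (srt i)) (y : ∀ i, (F.obj k).carrier (srt i))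
    (h : ∀ i, colimMk F j (x i) = colimMk F k (y i)) :
    ∃ (l : J) (f : j ⟶ l) (g : k ⟶ l), ∀ i, (F.map f).map _ (x i) = (F.map g).map _ (y i) := by
  have h' : ∀ i, ∃ (l : J) (f : j ⟶ l) (g : k ⟶ l),
      (F.map f).map _ (x i) = (F.map g).map _ (y i) := fun i => Quotient.exact (h i)
  choose l f g e using h'
  obtain ⟨n, a, b, hab⟩ := IsCardinalFiltered.wideSpan f hι
  -- The wide span makes the composites out of `j` agree, but those out of `k` may still differ;
  -- they are fewer than `κ` parallel arrows, so a later stage merges them.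
  let c := IsCardinalFiltered.coeqHom (fun i => g i ≫ a i) hι
  refine ⟨_, b ≫ c, IsCardinalFiltered.toCoeq (fun i => g i ≫ a i) hι, fun i => ?_⟩
  rw [← IsCardinalFiltered.coeq_condition _ hι i, ← hab i, Category.assoc, Category.assoc,
    ← map_map_apply, ← map_map_apply, e i, map_map_apply, map_map_apply]

theorem exists_map_eq_map {s : S} {j k : J} (x : (F.obj j).carrier s) (y : (F.obj k).carrier s)
    (h : colimMk F j x = colimMk F k y) :
    ∃ (l : J) (f : j ⟶ l) (g : k ⟶ l), (F.map f).map _ x = (F.map g).map _ y :=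
  Quotient.exact h

theorem exists_colimMk_eq {ι : Type u} (hι : HasCardinalLT ι κ) {srt : ι → S}
    (a : ∀ i, ColimCarrier F (srt i)) :
    ∃ (j : J) (x : ∀ i, (F.obj j).carrier (srt i)), ∀ i, colimMk F j (x i) = a i := by
  choose x hx using fun i => Quotient.exists_rep (a i)
  refine ⟨IsCardinalFiltered.max (fun i => (x i).1) hι,
    fun i => (F.map (IsCardinalFiltered.toMax (fun i => (x i).1) hι i)).map _ (x i).2, fun i => ?_⟩
  rw [colimMk_map, ← hx i]
  rfl

variable (F) in
/-- The graph of a function symbol in the colimit of a filtered diagram. -/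
def ColimGraph (f : τ.Fn) (a : (τ.fnArity f).Prod (ColimCarrier F))
    (b : ColimCarrier F (τ.fnType f)) : Prop :=
  ∃ (j : J) (a' : (τ.fnArity f).Prod (F.obj j).carrier) (b' : (F.obj j).carrier (τ.fnType f)),
    (∀ i, colimMk F j (a' i) = a i) ∧ b' ∈ (F.obj j).fn f a' ∧ colimMk F j b' = b

theorem ColimGraph.unique {f : τ.Fn} {a : (τ.fnArity f).Prod (ColimCarrier F)}
    {b c : ColimCarrier F (τ.fnType f)} (hb : ColimGraph F f a b) (hc : ColimGraph F f a c) :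
    b = c := by
  obtain ⟨j, a₁, b₁, ha₁, hb₁, rfl⟩ := hb
  obtain ⟨k, a₂, b₂, ha₂, hb₂, rfl⟩ := hc
  obtain ⟨l, g, h, e⟩ := exists_map_eq (hasCardinalLT_Iio _) a₁ a₂
    fun i => (ha₁ i).trans (ha₂ i).symm
  have k₁ := (F.map g).map_fn f _ _ hb₁
  have k₂ := (F.map h).map_fn f _ _ hb₂
  rw [← funext e] at k₂
  rw [← colimMk_map g, ← colimMk_map h, Part.mem_unique k₁ k₂]

variable (F) in
/-- The colimit of a filtered diagram of partial structures. -/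
noncomputable def PStr.colim : PStr τ where
  carrier := ColimCarrier F
  fn f a := ⟨∃ b, ColimGraph F f a b, fun h => h.choose⟩
  rel R := {a | ∃ (j : J) (a' : (τ.relArity R).Prod (F.obj j).carrier),
    (∀ i, colimMk F j (a' i) = a i) ∧ a' ∈ (F.obj j).rel R}

theorem PStr.mem_colim_fn {f : τ.Fn} {a : (τ.fnArity f).Prod (ColimCarrier F)}
    {b : ColimCarrier F (τ.fnType f)} : b ∈ (PStr.colim F).fn f a ↔ ColimGraph F f a b := by
  constructor
  · rintro ⟨h, rfl⟩
    exact h.choose_spec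
  · intro h
    exact ⟨⟨b, h⟩, (Exists.choose_spec (⟨b, h⟩ : ∃ b, ColimGraph F f a b)).unique h⟩

variable (F) in
/-- The coprojections to the colimit of a filtered diagram of partial structures. -/
noncomputable def PStr.colimι (j : J) : F.obj j ⟶ PStr.colim F :=
  PStr.Hom.mk (fun _ x => colimMk F j x)
    (fun _ a b h => PStr.mem_colim_fn.2 ⟨j, a, b, fun _ => rfl, h, rfl⟩)
    (fun _ a h => ⟨j, a, fun _ => rfl, h⟩)

theorem PStr.map_colimι {j k : J} (g : j ⟶ k) :
    F.map g ≫ PStr.colimι F k = PStr.colimι F j :=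
  PStr.Hom.ext (funext fun _ => funext fun x => colimMk_map g x)

/-- The homomorphism out of a filtered colimit induced by a cocone. -/
noncomputable def PStr.colimDesc {C : PStr τ} (h : ∀ j, F.obj j ⟶ C)
    (w : ∀ {j k : J} (g : j ⟶ k), F.map g ≫ h k = h j) : PStr.colim F ⟶ C :=
  have w' : ∀ {j k : J} (g : j ⟶ k) {s : S} (x : (F.obj j).carrier s),
      (h k).map s ((F.map g).map s x) = (h j).map s x :=
    fun g _ x => congrArg (fun q : F.obj _ ⟶ C => q.map _ x) (w g)
  PStr.Hom.mk
    (fun s => Quotient.lift (fun x => (h x.1).map s x.2) (by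
      rintro x y ⟨k, f, g, e⟩
      rw [← w' f, ← w' g, e]))
    (fun f a b hb => by
      obtain ⟨j, a', b', ha, hb', rfl⟩ := PStr.mem_colim_fn.1 hb
      obtain rfl : (fun i => colimMk F j (a' i)) = a := funext ha
      exact (h j).map_fn f a' b' hb')
    (fun R a hR => by
      obtain ⟨j, a', ha, hR'⟩ := hR
      obtain rfl : (fun i => colimMk F j (a' i)) = a := funext ha
      exact (h j).map_rel R a' hR')

theorem PStr.colim_hom_ext {C : PStr τ} {g h : PStr.colim F ⟶ C}
    (e : ∀ j, PStr.colimι F j ≫ g = PStr.colimι F j ≫ h) : g = h := by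
  refine PStr.Hom.ext (funext fun s => funext fun x => ?_)
  obtain ⟨⟨j, x⟩, rfl⟩ := Quotient.exists_rep x
  exact congrArg (fun q : F.obj j ⟶ C => q.map s x) (e j)

/-- The common step for function and relation symbols: the arguments are evaluated at stages of
their own, while the symbol is applied to representatives `a'` at yet another stage. Since arities
are below `κ`, one stage reconciles all of them. -/
theorem exists_forall_mem_eval {ι : Type u} (hι : HasCardinalLT ι κ) {srt : ι → S}
    {t : ∀ i, Term τ Γ (srt i)} {j : J} {m : Γ.Prod (F.obj j).carrier}
    {a : ∀ i, ColimCarrier F (srt i)}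
    (h : ∀ i, ∃ (k : J) (g : j ⟶ k), ∃ b ∈ (t i).eval (F.obj k) fun x => (F.map g).map _ (m x),
      colimMk F k b = a i)
    {l : J} {a' : ∀ i, (F.obj l).carrier (srt i)} (ha : ∀ i, colimMk F l (a' i) = a i) :
    ∃ (n : J) (w : j ⟶ n) (v : l ⟶ n),
      ∀ i, (F.map v).map _ (a' i) ∈ (t i).eval (F.obj n) fun x => (F.map w).map _ (m x) := by
  choose k g b hb e using h
  obtain ⟨r, p, q, hpq⟩ := IsCardinalFiltered.wideSpan g hι
  obtain ⟨n, u, v, huv⟩ := exists_map_eq hι (fun i => (F.map (p i)).map _ (b i)) a' fun i => by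
    rw [colimMk_map, e i, ha i]
  refine ⟨n, q ≫ u, v, fun i => ?_⟩
  have h := PStr.Hom.map_eval (F.map (p i ≫ u)) (hb i)
  have hw : g i ≫ p i ≫ u = q ≫ u := by rw [← Category.assoc, hpq]
  rw [← map_map_apply, huv] at h
  simpa only [map_map_apply, hw] using h

theorem exists_mem_eval_of_colim {j : J} {m : Γ.Prod (F.obj j).carrier} {s : S} {t : Term τ Γ s}
    {b : ColimCarrier F s} (hb : b ∈ t.eval (PStr.colim F) fun i => colimMk F j (m i)) :
    ∃ (k : J) (g : j ⟶ k), ∃ b' ∈ t.eval (F.obj k) fun i => (F.map g).map _ (m i),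
      colimMk F k b' = b := by
  induction t with
  | var i =>
    refine ⟨j, 𝟙 j, _, mem_eval_var.2 rfl, ?_⟩
    rw [colimMk_map]
    exact (mem_eval_var.1 hb).symm
  | app f args ih =>
    obtain ⟨a, ha, hb⟩ := mem_eval_app.1 hb
    obtain ⟨l, a₂, b₂, ha₂, hb₂, rfl⟩ := PStr.mem_colim_fn.1 hb
    obtain ⟨n, w, v, h⟩ := exists_forall_mem_eval (hasCardinalLT_Iio _) (fun i => ih i (ha i)) ha₂
    exact ⟨n, w, (F.map v).map _ b₂, mem_eval_app.2 ⟨_, h, (F.map v).map_fn f _ _ hb₂⟩,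
      colimMk_map _ _⟩

theorem exists_holds_of_colim {j : J} {m : Γ.Prod (F.obj j).carrier} {φ : Formula τ Γ}
    (hφ : φ.Holds (PStr.colim F) fun i => colimMk F j (m i)) :
    ∃ (k : J) (g : j ⟶ k), φ.Holds (F.obj k) fun i => (F.map g).map _ (m i) := by
  induction φ with
  | rel R args =>
    obtain ⟨a, ha, hR⟩ := holds_rel.1 hφ
    obtain ⟨l, a₂, ha₂, hR₂⟩ := hR
    obtain ⟨n, w, v, h⟩ := exists_forall_mem_eval (hasCardinalLT_Iio _)
      (fun i => exists_mem_eval_of_colim (ha i)) ha₂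
    exact ⟨n, w, holds_rel.2 ⟨_, h, (F.map v).map_rel R _ hR₂⟩⟩
  | eq t t' =>
    obtain ⟨a, ha, ha'⟩ := holds_eq.1 hφ
    obtain ⟨k, g, b, hb, rfl⟩ := exists_mem_eval_of_colim ha
    obtain ⟨k', g', b', hb', e⟩ := exists_mem_eval_of_colim ha'
    obtain ⟨l, u, v, huv⟩ := exists_map_eq_map _ _ e
    have := isFiltered_of_isCardinalFiltered J κ
    -- The two values now agree, but the terms are evaluated at images of `m` along two possibly
    -- different arrows from `j`; these must be merged too.
    let c := IsFiltered.coeqHom (g ≫ v) (g' ≫ u)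
    have hc : g ≫ v ≫ c = g' ≫ u ≫ c := by
      simpa only [Category.assoc] using IsFiltered.coeq_condition (g ≫ v) (g' ≫ u)
    have h := PStr.Hom.map_eval (F.map (v ≫ c)) hb
    have h' := PStr.Hom.map_eval (F.map (u ≫ c)) hb'
    rw [← map_map_apply, ← huv, map_map_apply] at h
    simp only [map_map_apply, ← hc] at h h'
    exact ⟨_, g ≫ v ≫ c, holds_eq.2 ⟨_, h, h'⟩⟩
  | top => exact ⟨j, 𝟙 j, trivial⟩
  | conj β φ ih =>
    choose k g h using fun i => ih i (holds_conj.1 hφ i)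
    obtain ⟨l, p, q, hpq⟩ := IsCardinalFiltered.wideSpan g (hasCardinalLT_Iio _)
    refine ⟨l, q, holds_conj.2 fun i => ?_⟩
    have h := PStr.Hom.map_holds (F.map (p i)) (h i)
    simp only [map_map_apply, hpq] at h
    exact h

/-- A tuple has fewer than `κ` entries, so it comes from one stage; at a later stage the premise
already holds, hence so does the conclusion, which the coprojection carries to the colimit. -/
theorem Sequent.Valid.colim {q : Sequent τ} (hq : ∀ j, q.Valid (F.obj j)) :
    q.Valid (PStr.colim F) := fun m hm => by
  obtain ⟨j, m, rfl⟩ : ∃ (j : J) (m' : q.ctx.Prod (F.obj j).carrier),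
      (fun i => colimMk F j (m' i)) = m :=
    let ⟨j, x, hx⟩ := exists_colimMk_eq (hasCardinalLT_Iio _) m
    ⟨j, x, funext hx⟩
  obtain ⟨k, g, h⟩ := exists_holds_of_colim hm
  have h' := PStr.Hom.map_holds (PStr.colimι F k) (hq k _ h)
  rwa [show (fun i => (PStr.colimι F k).map _ ((F.map g).map _ (m i))) =
    fun i => colimMk F j (m i) from funext fun i => colimMk_map g (m i)] at h'

end FilteredColimits

/-! ### Algebras as models of a Horn theory over `Σ + Ω`. -/

section Algebras

variable {S : Type u} {κ : Cardinal.{u}} {σ : Signature S κ} {Ω : RelSignature σ} {Γ : Ctx S κ}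

/-- The `Σ`-structure underlying a `(Σ + Ω)`-structure. -/
def PStr.reduct (N : PStr Ω.total) : PStr σ where
  carrier := N.carrier
  fn f := N.fn (Sum.inl f)
  rel := N.rel

theorem Term.eval_lift {N : PStr Ω.total} {m : Γ.Prod N.carrier} {s : S} (t : Term σ Γ s) :
    (t.lift Ω).eval N m = t.eval N.reduct m := by
  induction t with
  | var i => rfl
  | app f args ih =>
    refine Part.ext fun b => ?_
    refine (mem_eval_app (τ := Ω.total)).trans (Iff.trans ?_ mem_eval_app.symm)
    exact exists_congr fun a => and_congr (forall_congr' fun j => Part.ext_iff.1 (ih j) (a j)) Iff.rfl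

theorem Formula.holds_lift {N : PStr Ω.total} {m : Γ.Prod N.carrier} (φ : Formula σ Γ) :
    (φ.lift Ω).Holds N m ↔ φ.Holds N.reduct m := by
  induction φ with
  | rel R args =>
    refine (holds_rel (τ := Ω.total)).trans (Iff.trans ?_ holds_rel.symm)
    exact exists_congr fun a => and_congr
      (forall_congr' fun j => Part.ext_iff.1 (args j).eval_lift (a j)) Iff.rfl
  | eq t t' => simp only [Formula.lift, Formula.Holds, Term.eval_lift]; rfl
  | top => exact Iff.rfl
  | conj β φ ih => simp only [Formula.lift, Formula.Holds, ih]

/-- The formula stating that an operator is defined at the variables of its arity. -/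
def RelSignature.opDefined (Ω : RelSignature σ) (ω : Ω.Op) :
    Formula Ω.total (Ω.arityCtx ω) :=
  let t : Term Ω.total (Ω.arityCtx ω) (Ω.type ω) :=
    Term.app (σ := Ω.total) (Sum.inr ω) fun j => Term.var j
  .eq t t

theorem RelSignature.holds_opDefined {N : PStr Ω.total} {ω : Ω.Op}
    {m : (Ω.arityCtx ω).Prod N.carrier} :
    (Ω.opDefined ω).Holds N m ↔ (N.fn (Sum.inr ω) m).Dom := by
  refine (holds_eq_self (τ := Ω.total)).trans ?_
  rw [Part.dom_iff_mem, Part.dom_iff_mem]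
  refine exists_congr fun b => (mem_eval_app (τ := Ω.total)).trans ?_
  constructor
  · rintro ⟨a, ha, hb⟩
    rwa [funext fun j => mem_eval_var.1 (ha j)] at hb
  · exact fun hb => ⟨m, fun j => mem_eval_var.2 rfl, hb⟩

variable (T : Theory σ) (E : Set (Judgment Ω))

/-- The partial Horn theory over `Σ + Ω` whose models are the algebras of `(Ω, E)`. -/
inductive TotalTheory : Theory Ω.total
  | base (q : Sequent σ) : q ∈ T → TotalTheory ⟨q.ctx, q.lhs.lift Ω, q.rhs.lift Ω⟩
  | dom (ω : Ω.Op) : TotalTheory ⟨Ω.arityCtx ω, Ω.opDefined ω, (Ω.arity ω).lift Ω⟩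
  | total (ω : Ω.Op) : TotalTheory ⟨Ω.arityCtx ω, (Ω.arity ω).lift Ω, Ω.opDefined ω⟩
  | judgment (J : Judgment Ω) : J ∈ E → TotalTheory J.toSequent

variable {T E}

theorem valid_toPStr (A : Alg T E) {q : Sequent Ω.total} (hq : q ∈ TotalTheory T E) :
    q.Valid A.obj.toPStr := by
  cases hq with
  | base q hq =>
    exact fun m hm => (Formula.holds_lift _).2 (A.obj.model.property q hq m
      ((Formula.holds_lift _).1 hm))
  | dom ω =>
    exact fun m hm => (Formula.holds_lift _).2 (RelSignature.holds_opDefined.1 hm)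
  | total ω =>
    exact fun m hm => RelSignature.holds_opDefined.2 ((Formula.holds_lift _).1 hm)
  | judgment J hJ => exact A.property J hJ

/-- The algebra given by a model of `TotalTheory T E`. -/
def Algebra.ofPStr (N : PStr Ω.total) (h : ∀ q ∈ TotalTheory T E, q.Valid N) :
    Algebra T Ω where
  model := ⟨N.reduct, fun q hq m hm =>
    (Formula.holds_lift _).1 (h _ (.base q hq) m ((Formula.holds_lift _).2 hm))⟩
  op ω m := (N.fn (Sum.inr ω) m.1).get
    (RelSignature.holds_opDefined.1 (h _ (.total ω) m.1 ((Formula.holds_lift _).2 m.2)))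

/-- The domain of an operator is replaced by the extension of its arity, an equivalent proposition
but not the same one by definition. Hence the later transport along `ofPStrIso`. -/
theorem Algebra.toPStr_ofPStr (N : PStr Ω.total) (h : ∀ q ∈ TotalTheory T E, q.Valid N) :
    (Algebra.ofPStr N h).toPStr = N := by
  have key : (Algebra.ofPStr N h).toPStr.fn = N.fn := by
    funext f m
    cases f with
    | inl f => rfl
    | inr ω =>
      exact Part.ext' ⟨fun hm => RelSignature.holds_opDefined.1
          (h _ (.total ω) m ((Formula.holds_lift _).2 hm)),
        fun hm => (Formula.holds_lift _).1 (h _ (.dom ω) m (RelSignature.holds_opDefined.2 hm))⟩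
        fun _ _ => rfl
  change PStr.mk N.carrier (Algebra.ofPStr N h).toPStr.fn N.rel = N
  rw [key]

/-- The object of `Alg T E` given by a model of `TotalTheory T E`. -/
def Alg.ofPStr (N : PStr Ω.total) (h : ∀ q ∈ TotalTheory T E, q.Valid N) : Alg T E :=
  ⟨Algebra.ofPStr N h, fun J hJ => by
    rw [Algebra.toPStr_ofPStr]
    exact h _ (.judgment J hJ)⟩

variable (T E) in
/-- The functor regarding algebras as `(Σ + Ω)`-structures. -/
def toStr : Alg T E ⥤ PStr Ω.total where
  obj A := A.obj.toPStr
  map h := h.hom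

variable (T E) in
/-- Algebras form a full subcategory of the `(Σ + Ω)`-structures. -/
def fullyFaithfulToStr : (toStr T E).FullyFaithful where
  preimage h := ObjectProperty.homMk h

instance : (toStr T E).Full := (fullyFaithfulToStr T E).full

instance : (toStr T E).Faithful := (fullyFaithfulToStr T E).faithful

/-- The structure underlying `Alg.ofPStr N h` is `N`. -/
def ofPStrIso (N : PStr Ω.total) (h : ∀ q ∈ TotalTheory T E, q.Valid N) :
    (toStr T E).obj (Alg.ofPStr N h) ≅ N :=
  eqToIso (Algebra.toPStr_ofPStr N h)

theorem valid_ofPStr {N : PStr Ω.total} {h : ∀ q ∈ TotalTheory T E, q.Valid N}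
    {q : Sequent Ω.total} (hq : q.Valid N) : q.Valid ((toStr T E).obj (Alg.ofPStr N h)) :=
  .of_retract (ofPStrIso N h).inv (ofPStrIso N h).hom (Iso.hom_inv_id _) hq

section Preimage

variable {A B X : Alg T E} {N : PStr Ω.total} (e : (toStr T E).obj X ≅ N)

theorem preimage_comp_preimage (a : (toStr T E).obj A ⟶ N) (b : N ⟶ (toStr T E).obj B) :
    (toStr T E).preimage (a ≫ e.inv) ≫ (toStr T E).preimage (e.hom ≫ b) =
      (toStr T E).preimage (a ≫ b) :=
  (toStr T E).map_injective (by simp)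

theorem eq_preimage_comp_inv (a : (toStr T E).obj A ⟶ N) (m : A ⟶ X) :
    m = (toStr T E).preimage (a ≫ e.inv) ↔ (toStr T E).map m ≫ e.hom = a := by
  rw [← (toStr T E).map_injective.eq_iff, Functor.map_preimage, Iso.eq_comp_inv]

theorem eq_preimage_hom_comp (b : N ⟶ (toStr T E).obj B) (m : X ⟶ B) :
    m = (toStr T E).preimage (e.hom ≫ b) ↔ e.inv ≫ (toStr T E).map m = b := by
  rw [← (toStr T E).map_injective.eq_iff, Functor.map_preimage, Iso.inv_comp_eq]

end Preimage

/-! ### Products -/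

theorem valid_pi {J : Type u} (F : J → Alg T E) (q : Sequent Ω.total)
    (hq : q ∈ TotalTheory T E) : q.Valid (PStr.pi fun j => (toStr T E).obj (F j)) :=
  Sequent.Valid.pi fun j => valid_toPStr (F j) hq

/-- The cone given by the product of a family of algebras. -/
noncomputable def Alg.piCone {J : Type u} (F : Discrete J ⥤ Alg T E) : Cone F where
  pt := Alg.ofPStr _ (valid_pi fun j => F.obj ⟨j⟩)
  π := Discrete.natTrans fun j => (toStr T E).preimage
    ((ofPStrIso _ (valid_pi fun j => F.obj ⟨j⟩)).hom ≫ PStr.piProj _ j.as)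

/-- The product cone is a limit cone. -/
noncomputable def Alg.isLimitPiCone {J : Type u} (F : Discrete J ⥤ Alg T E) : IsLimit (Alg.piCone F) where
  lift s := (toStr T E).preimage (PStr.piLift (fun j => (toStr T E).map (s.π.app ⟨j⟩)) ≫
    (ofPStrIso _ (valid_pi fun j => F.obj ⟨j⟩)).inv)
  fac s j := (preimage_comp_preimage (ofPStrIso _ (valid_pi fun j => F.obj ⟨j⟩)) _ _).trans
    ((toStr T E).preimage_map _)
  uniq s m hm := by
    refine (eq_preimage_comp_inv (ofPStrIso _ (valid_pi fun j => F.obj ⟨j⟩)) _ _).2 ?_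
    refine PStr.Hom.ext (funext fun t => funext fun a => funext fun j => ?_)
    have h := ((toStr T E).map_comp m ((Alg.piCone F).π.app ⟨j⟩)).symm.trans
      (congrArg (toStr T E).map (hm ⟨j⟩))
    have h₀ : (toStr T E).map ((Alg.piCone F).π.app ⟨j⟩) =
      (ofPStrIso _ (valid_pi fun j => F.obj ⟨j⟩)).hom ≫ PStr.piProj _ j := Functor.map_preimage _ _
    exact congrArg (fun g : (toStr T E).obj s.pt ⟶ (toStr T E).obj (F.obj ⟨j⟩) => g.map t a)
      ((congrArg ((toStr T E).map m ≫ ·) h₀).symm.trans h)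

/-! ### Filtered colimits -/

section Colim

variable [Fact κ.IsRegular] {J : Type u} [SmallCategory J] [IsCardinalFiltered J κ]
  (F : J ⥤ Alg T E)

theorem valid_colim (q : Sequent Ω.total) (hq : q ∈ TotalTheory T E) :
    q.Valid (PStr.colim (F ⋙ toStr T E)) :=
  Sequent.Valid.colim fun j => valid_toPStr (F.obj j) hq

/-- The cocone given by the colimit of a filtered diagram of algebras. -/
noncomputable def Alg.colimCocone : Cocone F where
  pt := Alg.ofPStr _ (valid_colim F)
  ι :=
    { app j := (toStr T E).preimage
        (PStr.colimι (F ⋙ toStr T E) j ≫ (ofPStrIso _ (valid_colim F)).inv)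
      naturality j k g := by
        refine (toStr T E).map_injective ?_
        simp only [Functor.map_comp, Functor.map_preimage, Functor.const_obj_map,
          Functor.const_obj_obj, Category.comp_id]
        rw [← Category.assoc]
        exact congrArg (· ≫ _) (PStr.map_colimι (F := F ⋙ toStr T E) g) }

/-- The concrete filtered colimit is a colimit. -/
noncomputable def Alg.isColimitColimCocone : IsColimit (Alg.colimCocone F) where
  desc s := (toStr T E).preimage ((ofPStrIso _ (valid_colim F)).hom ≫
    PStr.colimDesc (F := F ⋙ toStr T E) (fun j => (toStr T E).map (s.ι.app j))
      fun g => by rw [Functor.comp_map, ← Functor.map_comp, s.w])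
  fac s j := (preimage_comp_preimage (ofPStrIso _ (valid_colim F)) _ _).trans
    ((toStr T E).preimage_map _)
  uniq s m hm := by
    refine (eq_preimage_hom_comp (ofPStrIso _ (valid_colim F)) _ _).2 ?_
    refine PStr.colim_hom_ext fun j => ?_
    have h := ((toStr T E).map_comp ((Alg.colimCocone F).ι.app j) m).symm.trans
      (congrArg (toStr T E).map (hm j))
    have h₀ : (toStr T E).map ((Alg.colimCocone F).ι.app j) =
      PStr.colimι (F ⋙ toStr T E) j ≫ (ofPStrIso _ (valid_colim F)).inv := Functor.map_preimage _ _
    exact (Category.assoc _ _ _).symm.trans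
      ((congrArg (· ≫ (toStr T E).map m) h₀).symm.trans h)

end Colim

/-! ### Monomorphisms and closed embeddings -/

/-- The kernel pair is an algebra whose projections are equalised by `m`, so they coincide. -/
theorem injective_of_mono {A B : Alg T E} (m : A ⟶ B) [Mono m] (s : S) :
    Function.Injective (((toStr T E).map m).map s) := by
  intro a b hab
  have hK : ∀ q ∈ TotalTheory T E, q.Valid (PStr.ker ((toStr T E).map m)) :=
    fun q hq => Sequent.Valid.ker (valid_toPStr A hq)
  have key : (toStr T E).preimage ((ofPStrIso _ hK).hom ≫ PStr.kerFst ((toStr T E).map m)) =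
      (toStr T E).preimage ((ofPStrIso _ hK).hom ≫ PStr.kerSnd ((toStr T E).map m)) := by
    rw [← cancel_mono m]
    refine (toStr T E).map_injective ?_
    simp only [Functor.map_comp, Functor.map_preimage, Category.assoc, PStr.kerFst_comp]
  have key' := congrArg (toStr T E).map key
  rw [Functor.map_preimage, Functor.map_preimage, cancel_epi] at key'
  exact congrArg (fun g : PStr.ker ((toStr T E).map m) ⟶ (toStr T E).obj A =>
    g.map s ⟨(a, b), hab⟩) key'

/-- The domain of an operator is defined by a Horn formula over `Σ`, which a `Σ`-closed injection
reflects; closedness for `Ω` is thus automatic. -/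
theorem isClosedEmb_of_mono {A B : Alg T E} (m : A ⟶ B) [Mono m]
    (hm : IsClosedHom ((forget T E).map m).hom) : IsClosedEmb ((toStr T E).map m) := by
  have hi := injective_of_mono m
  refine ⟨⟨fun f => ?_, hm.2⟩, hi⟩
  cases f with
  | inl f => exact hm.1 f
  | inr ω => exact fun a => (IsClosedEmb.holds_iff (h := ((forget T E).map m).hom) ⟨hm, hi⟩).symm

theorem mono_of_injective {A B : Alg T E} (m : A ⟶ B)
    (h : ∀ s, Function.Injective (((toStr T E).map m).map s)) : Mono m := by
  refine ⟨fun f g e => (toStr T E).map_injective (PStr.Hom.ext ?_)⟩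
  funext s a
  exact h s (congrArg (fun k : _ ⟶ _ => ((toStr T E).map k).map s a) e)

end Algebras

/-! ### Definable classes are closed -/

section Definable

variable {S : Type u} {κ : Cardinal.{u}} {σ : Signature S κ} {Ω : RelSignature σ}
  {T : Theory σ} {E : Set (Judgment Ω)} {P : ObjectProperty (Alg T E)}

theorem isDefinable_iff : IsDefinable P ↔ ∃ E' : Set (Judgment Ω), ∀ A : Alg T E,
    P A ↔ ∀ J ∈ E', J.toSequent.Valid ((toStr T E).obj A) := by
  refine exists_congr fun E' => forall_congr' fun A => iff_congr Iff.rfl ?_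
  exact ⟨fun h J hJ => h J (Or.inr hJ), fun h J hJ => hJ.elim (A.property J) (h J)⟩

theorem IsDefinable.isClosedUnderProducts (hP : IsDefinable P) [P.IsClosedUnderIsomorphisms]
    (J : Type u) : P.IsClosedUnderLimitsOfShape (Discrete J) where
  limitsOfShape_le := by
    rintro A ⟨⟨p, hp⟩⟩
    obtain ⟨E', hE'⟩ := isDefinable_iff.1 hP
    refine P.prop_of_iso ((Alg.isLimitPiCone p.diag).conePointUniqueUpToIso p.isLimit) ?_
    exact (hE' _).2 fun q hq => valid_ofPStr (Sequent.Valid.pi fun j => (hE' _).1 (hp ⟨j⟩) q hq)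

theorem IsDefinable.isClosedUnderFilteredColimits [Fact κ.IsRegular] (hP : IsDefinable P)
    [P.IsClosedUnderIsomorphisms] (J : Type u) [SmallCategory J] [IsCardinalFiltered J κ] :
    P.IsClosedUnderColimitsOfShape J where
  colimitsOfShape_le := by
    rintro A ⟨⟨p, hp⟩⟩
    obtain ⟨E', hE'⟩ := isDefinable_iff.1 hP
    refine P.prop_of_iso
      ((Alg.isColimitColimCocone p.diag).coconePointUniqueUpToIso p.isColimit) ?_
    exact (hE' _).2 fun q hq => valid_ofPStr (Sequent.Valid.colim fun j => (hE' _).1 (hp j) q hq)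

theorem IsDefinable.closedUnderClosedSubobjects (hP : IsDefinable P) :
    ClosedUnderClosedSubobjects P := by
  intro A B m _ hm hB
  obtain ⟨E', hE'⟩ := isDefinable_iff.1 hP
  exact (hE' _).2 fun q hq => .of_isClosedEmb (isClosedEmb_of_mono m hm) ((hE' _).1 hB q hq)

/-- This is where the premise of a judgment has to be over `Σ`: the section need not preserve the
operators. -/
theorem IsDefinable.closedUnderRetractsAlong (hP : IsDefinable P) :
    ClosedUnderRetractsAlong (forget T E) P := by
  intro X Y f hf hX
  obtain ⟨E', hE'⟩ := isDefinable_iff.1 hP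
  refine (hE' _).2 fun q hq m hm => ?_
  let i := section_ ((forget T E).map f)
  have hi : i ≫ (forget T E).map f = 𝟙 _ := IsSplitEpi.id _
  have h₁ := (hE' _).1 hX q hq (fun k => i.hom.map _ (m k))
    ((Formula.holds_lift _).2 (PStr.Hom.map_holds i.hom ((Formula.holds_lift _).1 hm)))
  have h₂ := PStr.Hom.map_holds ((toStr T E).map f) h₁
  rwa [show (fun k => ((toStr T E).map f).map _ (i.hom.map _ (m k))) = m from
    funext fun k => congrArg (fun g : (forget T E).obj Y ⟶ (forget T E).obj Y =>
      g.hom.map _ (m k)) hi] at h₂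

end Definable

/-! ### Contexts indexed by arbitrary sets of size below `κ`. -/

section Contexts

variable {S : Type u} {κ : Cardinal.{u}}

theorem exists_Iio_equiv {Y : Type u} (h : Cardinal.mk Y < κ) :
    ∃ β : κ.ord.ToType, Nonempty (Set.Iio β ≃ Y) := by
  let β : κ.ord.ToType := Ordinal.ToType.mk ⟨(Cardinal.mk Y).ord, Cardinal.ord_lt_ord.2 h⟩
  refine ⟨β, Cardinal.eq.1 ?_⟩
  have h₁ : Ordinal.typein (α := κ.ord.ToType) (· < ·) β = (Cardinal.mk Y).ord :=
    Ordinal.typein_enum _ _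
  have h₂ := Ordinal.card_typein (r := ((· < ·) : κ.ord.ToType → κ.ord.ToType → Prop)) β
  rw [h₁, Cardinal.card_ord] at h₂
  exact h₂.symm

variable {Y : Type u} (srt : Y → S) (h : Cardinal.mk Y < κ)

/-- A context whose variables correspond to the elements of a given small sorted set. -/
noncomputable def Ctx.of : Ctx S κ where
  len := (exists_Iio_equiv h).choose
  sort k := srt ((exists_Iio_equiv h).choose_spec.some k)

/-- The enumeration of a small sorted set by the variables of the corresponding context. -/
noncomputable def Ctx.enum : (Ctx.of srt h).Idx ≃ Y :=
  (exists_Iio_equiv h).choose_spec.some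

variable {srt h}

/-- The assignment to the variables of `Ctx.of srt h` given by a sorted map. -/
noncomputable def Ctx.assign {X : S → Type u} (v : ∀ y, X (srt y)) : (Ctx.of srt h).Prod X :=
  fun k => v (Ctx.enum srt h k)

theorem Ctx.exists_assign_eq {X : S → Type u} (m : (Ctx.of srt h).Prod X) :
    ∃ v : ∀ y, X (srt y), Ctx.assign v = m :=
  ⟨Equiv.piCongrLeft (fun y => X (srt y)) (Ctx.enum srt h) m,
    funext fun k => Equiv.piCongrLeft_apply_apply (fun y => X (srt y)) (Ctx.enum srt h) m k⟩

theorem Ctx.exists_term (τ : Signature S κ) (h : Cardinal.mk Y < κ) (y : Y) :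
    ∃ t : Term τ (Ctx.of srt h) (srt y), ∀ (N : PStr τ) (v : ∀ y, N.carrier (srt y)),
      t.eval N (Ctx.assign v) = Part.some (v y) := by
  obtain ⟨k, rfl⟩ := (Ctx.enum srt h).surjective y
  exact ⟨Term.var k, fun _ _ => rfl⟩

end Contexts

/-! ### The `κ`-directed preorder of small pieces of a diagram. -/

section Diagrams

variable {S : Type u} {κ : Cardinal.{u}} {σ : Signature S κ}

/-- A small piece of the diagram of a partial structure: a set of fewer than `κ` elements and a
Horn formula about these elements that holds in the structure. -/
structure Diag (M : PStr σ) : Type u where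
  supp : Set (Σ s, M.carrier s)
  card_lt : Cardinal.mk supp < κ
  formula : Formula σ (Ctx.of (fun y : supp => y.1.1) card_lt)
  holds : formula.Holds M (Ctx.assign fun y => y.1.2)

namespace Diag

variable {M : PStr σ}

/-- The context of the elements of a piece of diagram. -/
noncomputable abbrev ctx (D : Diag M) : Ctx S κ := Ctx.of (fun y : D.supp => y.1.1) D.card_lt

/-- An assignment makes the formula of a piece of diagram true. -/
def Sat (D : Diag M) (N : PStr σ) (v : ∀ y : D.supp, N.carrier y.1.1) : Prop :=
  D.formula.Holds N (Ctx.assign v)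

-- The order is semantic entailment in all partial structures. Being a mere preorder, it makes `Diag
-- M` a thin category, so `κ`-filteredness reduces to upper bounds.
instance : Preorder (Diag M) where
  le i j := ∃ h : i.supp ⊆ j.supp, ∀ (N : PStr σ) (v : ∀ y : j.supp, N.carrier y.1.1),
    j.Sat N v → i.Sat N fun y => v ⟨y.1, h y.2⟩
  le_refl i := ⟨subset_rfl, fun _ _ h => h⟩
  le_trans i j k := fun ⟨h, hv⟩ ⟨h', hv'⟩ => ⟨h.trans h', fun N v hN => hv N _ (hv' N v hN)⟩

theorem mem_supp_of_le {i j : Diag M} (h : i ≤ j) {x : Σ s, M.carrier s} (hx : x ∈ i.supp) :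
    x ∈ j.supp := h.1 hx

theorem Sat.restrict {i j : Diag M} (h : i ≤ j) {N : PStr σ} {v : ∀ y : j.supp, N.carrier y.1.1}
    (hv : j.Sat N v) : i.Sat N fun y => v ⟨y.1, mem_supp_of_le h y.2⟩ :=
  h.2 N v hv

theorem exists_rel {R : σ.Rel} {a : (σ.relArity R).Prod M.carrier} (h : a ∈ M.rel R) :
    ∃ (D : Diag M) (ha : ∀ i, ⟨_, a i⟩ ∈ D.supp),
      ∀ (N : PStr σ) (v : ∀ y : D.supp, N.carrier y.1.1), D.Sat N v →
        (fun i => v ⟨⟨_, a i⟩, ha i⟩) ∈ N.rel R := by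
  let Z : Set (Σ s, M.carrier s) := Set.range fun i => ⟨_, a i⟩
  have hZ : Cardinal.mk Z < κ := Cardinal.mk_range_le.trans_lt (mk_Iio_lt _)
  choose t ht using Ctx.exists_term (srt := fun y : Z => y.1.1) σ hZ
  have ha : ∀ i, ⟨_, a i⟩ ∈ Z := fun i => ⟨i, rfl⟩
  have key : ∀ (N : PStr σ) (v : ∀ y : Z, N.carrier y.1.1),
      (Formula.rel R fun i => t ⟨_, ha i⟩).Holds N (Ctx.assign v) ↔
        (fun i => v ⟨⟨_, a i⟩, ha i⟩) ∈ N.rel R := by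
    intro N v
    rw [holds_rel]
    simp only [ht, Part.mem_some_iff]
    exact ⟨fun ⟨b, hb, hR⟩ => funext hb ▸ hR, fun h => ⟨_, fun _ => rfl, h⟩⟩
  exact ⟨⟨Z, hZ, _, (key _ _).2 h⟩, ha, fun N v => (key N v).1⟩

section Regular

variable [hκ : Fact κ.IsRegular]

/-- Take the union of the supports, small by regularity, and the conjunction of all the formulas
rewritten in the larger context. -/
theorem exists_forall_le {K : Type u} (D : K → Diag M) (hK : Cardinal.mk K < κ) :
    ∃ j, ∀ k, D k ≤ j := by
  let Z : Set (Σ s, M.carrier s) := ⋃ k, (D k).supp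
  have hZ : Cardinal.mk Z < κ :=
    (Cardinal.card_iUnion_lt_iff_forall_of_isRegular hκ.out hK).2 fun k => (D k).card_lt
  have hsub : ∀ k, (D k).supp ⊆ Z := fun k => Set.subset_iUnion (fun k => (D k).supp) k
  choose t ht using Ctx.exists_term (srt := fun y : Z => y.1.1) σ hZ
  let θ : ∀ k (x : (D k).ctx.Idx), Term σ (Ctx.of (fun y : Z => y.1.1) hZ) ((D k).ctx.sort x) :=
    fun k x => t ⟨(Ctx.enum _ _ x).1, hsub k (Ctx.enum _ _ x).2⟩
  have hθ : ∀ k (N : PStr σ) (v : ∀ y : Z, N.carrier y.1.1),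
      ((D k).formula.subst (θ k)).Holds N (Ctx.assign v) ↔
        (D k).Sat N fun y => v ⟨y.1, hsub k y.2⟩ := fun k N v =>
    Formula.holds_subst (fun x => ht _ N v) _
  obtain ⟨β, ⟨e⟩⟩ := exists_Iio_equiv hK
  refine ⟨⟨Z, hZ, .conj β fun b => (D (e b)).formula.subst (θ (e b)), ?_⟩, fun k => ⟨hsub k, ?_⟩⟩
  · exact holds_conj.2 fun b => (hθ _ _ _).2 (D (e b)).holds
  · intro N v hv
    obtain ⟨b, rfl⟩ := e.surjective k
    exact (hθ _ _ _).1 (holds_conj.1 hv b)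

instance : IsCardinalFiltered (Diag M) κ :=
  isCardinalFiltered_preorder _ _ fun _ s hs => exists_forall_le s hs

theorem exists_le_le (i j : Diag M) : ∃ k, i ≤ k ∧ j ≤ k := by
  have := isFiltered_of_isCardinalFiltered (Diag M) κ
  exact ⟨_, leOfHom (IsFiltered.leftToMax i j), leOfHom (IsFiltered.rightToMax i j)⟩

theorem exists_mem_supp {s : S} (x : M.carrier s) : ∃ D : Diag M, ⟨s, x⟩ ∈ D.supp :=
  ⟨⟨{⟨s, x⟩}, by simpa using hκ.out.nat_lt 1, .top, trivial⟩, Set.mem_singleton _⟩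

/-- The piece consists of the arguments, the value, and the equation between them. Such pieces later
make the section preserve the functions. -/
theorem exists_fn {f : σ.Fn} {a : (σ.fnArity f).Prod M.carrier} {b : M.carrier (σ.fnType f)}
    (h : b ∈ M.fn f a) :
    ∃ (D : Diag M) (ha : ∀ i, ⟨_, a i⟩ ∈ D.supp) (hb : ⟨_, b⟩ ∈ D.supp),
      ∀ (N : PStr σ) (v : ∀ y : D.supp, N.carrier y.1.1), D.Sat N v →
        v ⟨⟨_, b⟩, hb⟩ ∈ N.fn f fun i => v ⟨⟨_, a i⟩, ha i⟩ := by
  let Z : Set (Σ s, M.carrier s) := insert ⟨_, b⟩ (Set.range fun i => ⟨_, a i⟩)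
  have hZ : Cardinal.mk Z < κ := by
    refine Cardinal.mk_insert_le.trans_lt (Cardinal.add_lt_of_lt hκ.out.aleph0_le ?_ ?_)
    · exact Cardinal.mk_range_le.trans_lt (mk_Iio_lt _)
    · simpa using hκ.out.nat_lt 1
  choose t ht using Ctx.exists_term (srt := fun y : Z => y.1.1) σ hZ
  have ha : ∀ i, ⟨_, a i⟩ ∈ Z := fun i => Or.inr ⟨i, rfl⟩
  have hb : ⟨_, b⟩ ∈ Z := Or.inl rfl
  have key : ∀ (N : PStr σ) (v : ∀ y : Z, N.carrier y.1.1),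
      (Formula.eq (.app f fun i => t ⟨_, ha i⟩) (t ⟨_, hb⟩)).Holds N (Ctx.assign v) ↔
        v ⟨⟨_, b⟩, hb⟩ ∈ N.fn f fun i => v ⟨⟨_, a i⟩, ha i⟩ := by
    intro N v
    rw [holds_eq]
    simp only [mem_eval_app, ht, Part.mem_some_iff]
    constructor
    · rintro ⟨_, ⟨c, hc, hf⟩, rfl⟩
      rwa [← (funext hc : c = _)]
    · exact fun h => ⟨_, ⟨_, fun _ => rfl, h⟩, rfl⟩
  exact ⟨⟨Z, hZ, _, (key _ _).2 h⟩, ha, hb, fun N v => (key N v).1⟩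

end Regular

end Diag

end Diagrams

/-! ### Generic algebras and the retract argument. -/

section Generic

variable {S : Type u} {κ : Cardinal.{u}} {σ : Signature S κ} {Ω : RelSignature σ}
  {T : Theory σ} {E : Set (Judgment Ω)} (P : ObjectProperty (Alg T E))

/-- The judgments that are valid in all the algebras of a class. -/
def judgmentsOf : Set (Judgment Ω) :=
  {J | ∀ A : Alg T E, P A → J.toSequent.Valid ((toStr T E).obj A)}

variable {M : PStr σ}

/-- An assignment is generic for a class `P` of algebras and a piece of diagram if it satisfies the
latter, generates the structure, and satisfies only the formulas that hold for all assignments in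
`P` that satisfy the piece of diagram. -/
structure IsGeneric (D : Diag M) (N : PStr Ω.total) (v : ∀ y : D.supp, N.carrier y.1.1) :
    Prop where
  sat : D.Sat N.reduct v
  generates : N.Generates (Ctx.assign (h := D.card_lt) v)
  holds (ψ : Formula Ω.total D.ctx) : ψ.Holds N (Ctx.assign v) →
    ∀ (B : Alg T E) (w : ∀ y : D.supp, ((toStr T E).obj B).carrier y.1.1), P B →
      D.Sat ((toStr T E).obj B).reduct w → ψ.Holds ((toStr T E).obj B) (Ctx.assign w)

variable {P}

theorem IsGeneric.hom_ext {D : Diag M} {N C : PStr Ω.total} {v : ∀ y : D.supp, N.carrier y.1.1}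
    (hN : IsGeneric P D N v) {g h : N ⟶ C} (e : ∀ y, g.map _ (v y) = h.map _ (v y)) : g = h :=
  hN.generates.hom_ext fun _ => e _

/-- Genericity turns each formula true of the generators into a judgment with premise `D.formula`
valid in `P`, hence in `B`. -/
theorem IsGeneric.exists_hom {D : Diag M} {N : PStr Ω.total} {v : ∀ y : D.supp, N.carrier y.1.1}
    (hN : IsGeneric P D N v) {B : Alg T E}
    (hB : ∀ J ∈ judgmentsOf P, J.toSequent.Valid ((toStr T E).obj B))
    (w : ∀ y : D.supp, ((toStr T E).obj B).carrier y.1.1)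
    (hw : D.Sat ((toStr T E).obj B).reduct w) :
    ∃ h : N ⟶ (toStr T E).obj B, ∀ y, h.map _ (v y) = w y := by
  obtain ⟨h, hh⟩ := hN.generates.exists_hom (Ctx.assign w) fun ψ hψ => by
    refine hB ⟨D.ctx, D.formula, ψ⟩ (fun A hA m hm => ?_) _ ((Formula.holds_lift _).2 hw)
    obtain ⟨v', rfl⟩ := Ctx.exists_assign_eq m
    exact hN.holds ψ hψ A v' hA ((Formula.holds_lift _).1 hm)
  refine ⟨h, fun y => ?_⟩
  obtain ⟨k, rfl⟩ := (Ctx.enum (fun y : D.supp => y.1.1) D.card_lt).surjective y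
  exact hh k

theorem IsClosedEmb.comp {τ : Signature S κ} {L M N : PStr τ} {g : L ⟶ M} {h : M ⟶ N}
    (hg : IsClosedEmb g) (hh : IsClosedEmb h) : IsClosedEmb (g ≫ h) :=
  ⟨⟨fun f a => (hg.closed.1 f a).trans (hh.closed.1 f _),
    fun R a => (hg.closed.2 R a).trans (hh.closed.2 R _)⟩,
    fun s => (hh.inj s).comp (hg.inj s)⟩

theorem isClosedEmb_eqToHom {τ : Signature S κ} {M N : PStr τ} (h : M = N) :
    IsClosedEmb (eqToHom h) := by
  subst h
  exact ⟨⟨fun _ _ => Iff.rfl, fun _ _ => Iff.rfl⟩, fun _ => Function.injective_id⟩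

theorem ClosedUnderClosedSubobjects.prop (hP : ClosedUnderClosedSubobjects P) {A B : Alg T E}
    (h : (toStr T E).obj A ⟶ (toStr T E).obj B) (hh : IsClosedEmb h) (hB : P B) : P A := by
  obtain ⟨m, rfl⟩ := (toStr T E).map_surjective h
  exact hP m (mono_of_injective m hh.inj) ⟨fun f => hh.closed.1 (Sum.inl f), hh.closed.2⟩ hB

theorem exists_isGeneric (hpi : ∀ J : Type u, P.IsClosedUnderLimitsOfShape (Discrete J))
    (hsub : ClosedUnderClosedSubobjects P) (D : Diag M) :
    ∃ R : Alg T E, P R ∧ ∃ v, IsGeneric P D ((toStr T E).obj R) v := by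
  -- Indexing by refutable formulas, with one counterexample each, keeps the product small although
  -- `P` may be a proper class.
  let Bad : Type u := {ψ : Formula Ω.total D.ctx //
    ∃ (B : Alg T E) (w : ∀ y : D.supp, ((toStr T E).obj B).carrier y.1.1), P B ∧
      D.Sat ((toStr T E).obj B).reduct w ∧ ¬ ψ.Holds ((toStr T E).obj B) (Ctx.assign w)}
  choose B w hB hw hψ using fun ψ : Bad => ψ.2
  let Q := PStr.pi fun ψ => (toStr T E).obj (B ψ)
  let v : ∀ y : D.supp, Q.carrier y.1.1 := fun y ψ => w ψ y
  let N := PStr.span Q (Ctx.assign (h := D.card_lt) v)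
  let v' : ∀ y : D.supp, N.carrier y.1.1 := fun y =>
    ⟨v y, (Ctx.exists_term Ω.total D.card_lt y).imp fun t ht => by
      rw [ht]; exact Part.mem_some _⟩
  have hN : ∀ q ∈ TotalTheory T E, q.Valid N := fun q hq =>
    .of_isClosedEmb (PStr.isClosedEmb_spanIncl _ _) (valid_pi B q hq)
  have hgen : IsGeneric P D N v' := by
    refine ⟨?_, PStr.generates_spanGen Q _, fun ψ h C x hC hx => ?_⟩
    · refine (Formula.holds_lift _).1 ((PStr.isClosedEmb_spanIncl Q _).holds_iff.1 ?_)
      exact holds_pi.2 fun ψ => (Formula.holds_lift _).2 (hw ψ)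
    · by_contra hn
      exact hψ ⟨ψ, C, x, hC, hx, hn⟩
        (holds_pi.1 ((PStr.isClosedEmb_spanIncl Q _).holds_iff.2 h) _)
  refine ⟨Alg.ofPStr N hN, ?_, ?_⟩
  · have hQ : P (Alg.ofPStr Q (valid_pi B)) :=
      P.prop_of_isLimit (Alg.isLimitPiCone (Discrete.functor B)) fun j => hB j.as
    refine hsub.prop ((ofPStrIso N hN).hom ≫ PStr.spanIncl Q _ ≫
      (ofPStrIso Q (valid_pi B)).inv) ?_ hQ
    exact (isClosedEmb_eqToHom (Algebra.toPStr_ofPStr N hN)).comp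
      ((PStr.isClosedEmb_spanIncl _ _).comp
        (isClosedEmb_eqToHom (Algebra.toPStr_ofPStr Q (valid_pi B)).symm))
  · change ∃ v, IsGeneric P D (Algebra.ofPStr N hN).toPStr v
    rw [Algebra.toPStr_ofPStr]
    exact ⟨v', hgen⟩

theorem prop_of_forall_valid [Fact κ.IsRegular]
    (hpi : ∀ J : Type u, P.IsClosedUnderLimitsOfShape (Discrete J))
    (hsub : ClosedUnderClosedSubobjects P)
    (hret : ClosedUnderRetractsAlong (forget T E) P)
    (hcolim : ∀ (J : Type u) [SmallCategory J] [IsCardinalFiltered J κ],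
      P.IsClosedUnderColimitsOfShape J) (A : Alg T E)
    (hA : ∀ J ∈ judgmentsOf P, J.toSequent.Valid ((toStr T E).obj A)) : P A := by
  let M : PStr σ := ((toStr T E).obj A).reduct
  choose R hR v hv using exists_isGeneric (M := M) hpi hsub
  choose q hq using fun D : Diag M => (hv D).exists_hom hA (fun y => y.1.2) D.holds
  -- The target `R j` lies in `P`, so it validates the judgments of `P`; its generators satisfy the
  -- weaker piece `i` by restriction.
  choose r hr using fun {i j : Diag M} (h : i ≤ j) =>
    (hv i).exists_hom (fun J hJ => hJ (R j) (hR j)) (fun y => v j ⟨y.1, Diag.mem_supp_of_le h y.2⟩)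
      ((hv j).sat.restrict h)
  have hpre : ∀ {X Y : Alg T E} (f : (toStr T E).obj X ⟶ (toStr T E).obj Y) {s : S}
      (x : ((toStr T E).obj X).carrier s),
      ((toStr T E).map ((toStr T E).preimage f)).map s x = f.map s x := fun f s x => by
    rw [Functor.map_preimage]
  have hcomp : ∀ {X Y Z : Alg T E} (f : X ⟶ Y) (g : Y ⟶ Z) {s : S}
      (x : ((toStr T E).obj X).carrier s), ((toStr T E).map (f ≫ g)).map s x =
      ((toStr T E).map g).map s (((toStr T E).map f).map s x) := fun _ _ _ _ => rfl
  let G : Diag M ⥤ Alg T E :=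
    { obj := R
      map := fun {i j} g => (toStr T E).preimage (r (leOfHom g))
      map_id := fun i => (toStr T E).map_injective <| (hv i).hom_ext fun y =>
        (hpre _ _).trans (hr _ y)
      map_comp := fun {i j k} f g => (toStr T E).map_injective <| (hv i).hom_ext fun y => by
        rw [hcomp, hpre, hpre, hpre, hr, hr]
        exact (hr (leOfHom g) ⟨y.1, _⟩).symm }
  let c := Alg.colimCocone G
  have hc : IsColimit c := Alg.isColimitColimCocone G
  have hPc : P c.pt := P.prop_of_isColimit hc hR
  let d : Cocone G :=
    { pt := A
      ι :=
        { app := fun i => (toStr T E).preimage (q i)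
          naturality := fun i j g => (toStr T E).map_injective <| (hv i).hom_ext fun y => by
            refine (hcomp _ _ _).trans ?_
            rw [hpre, hpre, hr]
            exact (hq j ⟨y.1, _⟩).trans ((hpre _ _).trans (hq i y)).symm } }
  let p : c.pt ⟶ A := hc.desc d
  -- The element of the colimit named by `y` through the piece `i`; `el_eq` shows that the choice of
  -- piece is immaterial.
  let el : ∀ (i : Diag M) (y : i.supp), ((toStr T E).obj c.pt).carrier y.1.1 := fun i y =>
    ((toStr T E).map (c.ι.app i)).map _ (v i y)
  have el_le : ∀ {i j : Diag M} (h : i ≤ j) (y : i.supp), el j ⟨y.1, Diag.mem_supp_of_le h y.2⟩ = el i y := by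
    intro i j h y
    refine Eq.trans ?_ (congrArg (fun g : R i ⟶ c.pt => ((toStr T E).map g).map _ (v i y))
      (c.w (homOfLE h)))
    refine Eq.trans ?_ (hcomp _ _ _).symm
    exact congrArg _ ((hpre _ _).trans (hr h y)).symm
  have el_eq : ∀ {i j : Diag M} {s : S} {x : M.carrier s} (hi : ⟨s, x⟩ ∈ i.supp)
      (hj : ⟨s, x⟩ ∈ j.supp), el i ⟨_, hi⟩ = el j ⟨_, hj⟩ := by
    intro i j s x hi hj
    obtain ⟨k, hik, hjk⟩ := Diag.exists_le_le i j
    rw [← el_le hik, ← el_le hjk]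
  have p_el : ∀ (i : Diag M) (y : i.supp), ((toStr T E).map p).map _ (el i y) = y.1.2 := by
    intro i y
    refine (hcomp _ _ _).symm.trans ?_
    rw [hc.fac]
    exact (hpre _ _).trans (hq i y)
  choose D hD using fun s (x : M.carrier s) => Diag.exists_mem_supp x
  -- A fact of `M` is checked in a piece recording it, where the generators satisfy it; the
  -- coprojection then carries it to the colimit.
  let sec : M ⟶ ((toStr T E).obj c.pt).reduct := PStr.Hom.mk
    (fun s x => el (D s x) ⟨_, hD s x⟩)
    (fun f a b hb => by
      obtain ⟨i, ha, hb', h⟩ := Diag.exists_fn hb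
      rw [el_eq (hD _ b) hb', funext fun k => el_eq (hD _ (a k)) (ha k)]
      exact ((toStr T E).map (c.ι.app i)).map_fn (Sum.inl f) _ _ (h _ _ (hv i).sat))
    (fun Q a ha => by
      obtain ⟨i, ha', h⟩ := Diag.exists_rel ha
      rw [funext fun k => el_eq (hD _ (a k)) (ha' k)]
      exact ((toStr T E).map (c.ι.app i)).map_rel Q _ (h _ _ (hv i).sat))
  refine hret p ⟨⟨{ section_ := ObjectProperty.homMk sec, id := ?_ }⟩⟩ hPc
  refine ObjectProperty.hom_ext _ (PStr.Hom.ext (funext fun s => funext fun x => ?_))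
  exact p_el (D s x) ⟨_, hD s x⟩

end Generic

end RelAlg

theorem mainTheorem3 {S : Type u} (κ : Cardinal.{u}) [Fact κ.IsRegular]
    (σ : RelAlg.Signature S κ) (T : RelAlg.Theory σ)
    (Ω : RelAlg.RelSignature σ) (E : Set (RelAlg.Judgment Ω))
    (P : ObjectProperty (RelAlg.Alg T E)) [P.IsClosedUnderIsomorphisms] :
    RelAlg.IsDefinable P ↔
      ((∀ J : Type u, P.IsClosedUnderLimitsOfShape (Discrete J)) ∧
        RelAlg.ClosedUnderClosedSubobjects P ∧
        RelAlg.ClosedUnderRetractsAlong (RelAlg.forget T E) P ∧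
        (∀ (J : Type u) [SmallCategory J] [IsCardinalFiltered J κ],
          P.IsClosedUnderColimitsOfShape J)) := by
  refine ⟨fun h => ⟨h.isClosedUnderProducts, h.closedUnderClosedSubobjects,
    h.closedUnderRetractsAlong, fun J _ _ => h.isClosedUnderFilteredColimits J⟩, ?_⟩
  rintro ⟨hpi, hsub, hret, hcolim⟩
  exact RelAlg.isDefinable_iff.2 ⟨RelAlg.judgmentsOf P, fun A =>
    ⟨fun hA J hJ => hJ A hA, RelAlg.prop_of_forall_valid hpi hsub hret hcolim A⟩⟩
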